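/- For a real matrix $A$ let $\|A\|_F$ be its Frobenius norm, $\|A\|_{\rm op}$ its (Euclidean) operator norm, and $\mathrm{st}(A):=\|A\|_F^2/\|A\|_{\rm op}^2$ its stable rank. For $\sigma\colon\mathbb{R}\to\mathbb{R}$ let $\sigma(A)$ denote the matrix obtained by applying $\sigma$ entrywise, and let $\hat\sigma_1(s):=\mathbb{E}[\sigma(s\gamma)\gamma]$ with $\gamma\sim\mathcal N(0,1)$ be the first Hermite coefficient of $\gamma\mapsto\sigma(s\gamma)$. **Theorem (Nonlinear activation).** There exists a numerical constant $c>0$ such that the following holds. Let $W\in\mathbb{R}^{k\times d}$ be a random matrix with i.i.d. entries $\mathcal N(0,\tfrac1d)$, and let $X\in\mathbb{R}^{d\times n}$, $n\ge 1$, be a fixed matrix with nonzero columns $x_1,\dots,x_n\in\mathbb{R}^d$. Let $\sigma\colon\mathbb{R}\to\mathbb{R}$ be a $1$-Lipschitz function with $|\sigma(t)|\le|t|$ for all $t\in\mathbb{R}$, and suppose that $$p:=\min_{i=1,\dots,n}\ \frac{d}{\|x_i\|_2^2}\cdot\hat\sigma_1\!\left(\frac{\|x_i\|_2}{\sqrt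 d}\right)^{2}>0 .$$ Then for every $\varepsilon\in(0,1)$, with probability at least $1-8\exp(-c\,\varepsilon^2p^2k)$ the following inequalities hold simultaneously: $$(1-\varepsilon)\frac pd\|X\|_F^2\ \le\ \frac1k\|\sigma(WX)\|_F^2\ \le\ (1+\varepsilon)\frac1d\|X\|_F^2,\qquad (1-\varepsilon)\frac pd\|X\|_{\rm op}^2\ \le\ \frac1k\|\sigma(WX)\|_{\rm op}^2 .$$ Consequently, whenever these inequalities hold, $$\mathrm{st}(\sigma(WX))\ \le\ \frac{1+\varepsilon}{1-\varepsilon}\cdot\frac1p\cdot\mathrm{st}(X).$$ -/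

import Mathlib

open MeasureTheory ProbabilityTheory
open scoped NNReal

noncomputable section

namespace StableRank

open scoped Matrix.Norms.Frobenius in
/-- The Frobenius norm of a real matrix. -/
def frobNorm {m n : ℕ} (A : Matrix (Fin m) (Fin n) ℝ) : ℝ := ‖A‖

open scoped Matrix.Norms.L2Operator in
/-- The operator norm of a real matrix with respect to the Euclidean norms. -/
def opNorm {m n : ℕ} (A : Matrix (Fin m) (Fin n) ℝ) : ℝ := ‖A‖

/-- The stable rank `‖A‖_F² / ‖A‖_op²`. -/
def stableRank {m n : ℕ} (A : Matrix (Fin m) (Fin n) ℝ) : ℝ :=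
  frobNorm A ^ 2 / opNorm A ^ 2

/-- The Euclidean norm of the `j`-th column of `X`. -/
def colNorm {d n : ℕ} (X : Matrix (Fin d) (Fin n) ℝ) (j : Fin n) : ℝ :=
  ‖WithLp.toLp 2 (X.col j)‖

/-- The `m`-th Hermite polynomial, normalized to be orthonormal in `L²` of the standard Gaussian
(`Polynomial.hermite m` is the monic probabilists' polynomial, with squared norm `m!`). -/
def orthoHermite (m : ℕ) (t : ℝ) : ℝ :=
  Polynomial.aeval t (Polynomial.hermite m) / √(m.factorial : ℝ)

/-- The Hermite coefficient `E[σ(sγ) h_m(γ)]`, where `γ` is standard normal. -/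
def hermiteCoeff (σ : ℝ → ℝ) (m : ℕ) (s : ℝ) : ℝ :=
  ∫ γ, σ (s * γ) * orthoHermite m γ ∂(gaussianReal 0 1)

/-- The quantity `(d / ‖x_j‖²) · σ̂₁(‖x_j‖ / √d)²` attached to the `j`-th column of `X`. -/
def columnParam {d n : ℕ} (σ : ℝ → ℝ) (X : Matrix (Fin d) (Fin n) ℝ) (j : Fin n) : ℝ :=
  (d : ℝ) / colNorm X j ^ 2 * hermiteCoeff σ 1 (colNorm X j / √(d : ℝ)) ^ 2

/-- `W` is a random `k × d` matrix with i.i.d. entries of law `N(0, 1/d)`. -/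
structure IsGaussianMatrix {Ω : Type*} [MeasurableSpace Ω] (P : Measure Ω) {k d : ℕ}
    (W : Ω → Matrix (Fin k) (Fin d) ℝ) : Prop where
  law : ∀ i j, HasLaw (fun ω => W ω i j) (gaussianReal 0 ((d : ℝ≥0)⁻¹)) P
  indep : iIndepFun (fun (ij : Fin k × Fin d) ω => W ω ij.1 ij.2) P

/-- The two-sided bound on `‖σ(WX)‖_F²` and the lower bound on `‖σ(WX)‖_op²`. -/
def NormBounds {k d n : ℕ} (σ : ℝ → ℝ) (p ε : ℝ)
    (W : Matrix (Fin k) (Fin d) ℝ) (X : Matrix (Fin d) (Fin n) ℝ) : Prop :=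
  (1 - ε) * (p / d) * frobNorm X ^ 2 ≤ 1 / k * frobNorm ((W * X).map σ) ^ 2 ∧
  1 / k * frobNorm ((W * X).map σ) ^ 2 ≤ (1 + ε) * (1 / d) * frobNorm X ^ 2 ∧
  (1 - ε) * (p / d) * opNorm X ^ 2 ≤ 1 / k * opNorm ((W * X).map σ) ^ 2

end StableRank

end

/-! ### Chernoff bounds and one-dimensional Gaussian moments. -/

namespace StableRank

/-! The rows of `σ(WX)` are i.i.d. functions of the rows `w` of `W`, so the Frobenius bounds concern
a sum of i.i.d. variables `rowSq`. For the operator norm no net is needed: testing on one fixed `u`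
with `‖u‖ ≤ 1` gives `‖σ(WX)‖² ≥ ∑ᵢ f(wᵢ)²`, where `f` is `feature σ X u`.

Means. Bessel's inequality in each column gives `E rowSq ≥ (p/d)‖X‖_F²`. For `f`, take a top
singular vector `y`, put `z = Xy`, and let `u` be `y` reweighted by the first Hermite coefficients.
Gaussian projection turns the correlation of `f` with `z ⬝ᵥ w` into `√p ‖z‖²/d`, and Cauchy–Schwarz
yields `E f² ≥ (p/d)‖X‖_op²` (`exists_feature_sq_ge`).

Tails. For nonnegative variables the lower tail needs only a second moment
(`measureReal_sum_le_of_nonneg`), hence only fourth moments of `σ(WX)` and of `f`. The fourth moment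
of `f` must be controlled by `‖X‖_op`, not `‖X‖_F`; this is Gaussian concentration of a Lipschitz
function, proved by rotating one copy of `w` into an independent one
(`integral_feature_sub_pow_four_le`). The upper Frobenius tail uses an exponential moment and
Jensen's inequality over the columns (`exp_mul_rowSq_le`). -/

lemma exp_neg_le_quadratic {x : ℝ} (hx : 0 ≤ x) : Real.exp (-x) ≤ 1 - x + x ^ 2 / 2 := by
  have h := Real.quadratic_le_exp_of_nonneg hx
  rw [Real.exp_neg, inv_le_iff_one_le_mul₀ (Real.exp_pos x)]
  have h1 : 0 ≤ 1 - x + x ^ 2 / 2 := by nlinarith [sq_nonneg (x - 1)]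
  nlinarith [mul_le_mul_of_nonneg_left h h1, sq_nonneg (x ^ 2)]

/-- Chernoff bound for the lower tail of a sum of independent nonnegative variables, in terms of
the second moments alone. -/
lemma measureReal_sum_le_of_nonneg {Ω : Type*} [MeasurableSpace Ω] {P : Measure Ω}
    [IsProbabilityMeasure P] {k : ℕ} {Y : Fin k → Ω → ℝ} (hind : iIndepFun Y P)
    (hL : ∀ i, MemLp (Y i) 2 P) (h0 : ∀ i ω, 0 ≤ Y i ω) {b M ε : ℝ} (hb : 0 ≤ b) (hε : 0 ≤ ε)
    (hM : 0 < M) (hmean : ∀ i, b ≤ ∫ ω, Y i ω ∂P) (hsq : ∀ i, ∫ ω, Y i ω ^ 2 ∂P ≤ M) :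
    P.real {ω | ∑ i, Y i ω ≤ k * ((1 - ε) * b)} ≤ Real.exp (-(k * (ε ^ 2 * b ^ 2 / (2 * M)))) := by
  -- Minimizer of the exponent `-tεb + t²M/2` per summand.
  set t : ℝ := ε * b / M with ht
  have ht0 : 0 ≤ t := by positivity
  have hae : ∀ i, AEMeasurable (Y i) P := fun i => (hL i).aestronglyMeasurable.aemeasurable
  have hbdd : ∀ i, Integrable (fun ω => Real.exp (-t * Y i ω)) P := by
    intro i
    refine Integrable.of_bound (C := 1) ?_ ?_
    · exact (Real.measurable_exp.comp_aemeasurable ((hae i).const_mul _)).aestronglyMeasurable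
    · refine Filter.Eventually.of_forall fun ω => ?_
      rw [Real.norm_eq_abs, abs_of_pos (Real.exp_pos _), Real.exp_le_one_iff]
      nlinarith [h0 i ω, mul_nonneg ht0 (h0 i ω)]
  have hmgf : ∀ i, mgf (Y i) P (-t) ≤ Real.exp (-t * b + t ^ 2 * M / 2) := by
    intro i
    have hY1 : Integrable (Y i) P := (hL i).integrable one_le_two
    have hY2 : Integrable (fun ω => Y i ω ^ 2) P := (hL i).integrable_sq
    calc mgf (Y i) P (-t) = ∫ ω, Real.exp (-t * Y i ω) ∂P := rfl
      _ ≤ ∫ ω, (1 - t * Y i ω + t ^ 2 / 2 * Y i ω ^ 2) ∂P := by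
          refine integral_mono (hbdd i) ?_ fun ω => ?_
          · exact ((integrable_const 1).sub (hY1.const_mul t)).add (hY2.const_mul _)
          · have := exp_neg_le_quadratic (mul_nonneg ht0 (h0 i ω))
            simp only [neg_mul]
            linarith [mul_pow t (Y i ω) 2]
      _ = 1 - t * ∫ ω, Y i ω ∂P + t ^ 2 / 2 * ∫ ω, Y i ω ^ 2 ∂P := by
          have h1 : Integrable (fun ω => 1 - t * Y i ω) P :=
            (integrable_const 1).sub (hY1.const_mul t)
          rw [integral_add h1 (hY2.const_mul _),
            integral_sub (integrable_const 1) (hY1.const_mul t), integral_const_mul,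
            integral_const_mul]
          simp
      _ ≤ (-t * b + t ^ 2 * M / 2) + 1 := by
          nlinarith [mul_le_mul_of_nonneg_left (hmean i) ht0,
            mul_le_mul_of_nonneg_left (hsq i) (sq_nonneg t)]
      _ ≤ _ := Real.add_one_le_exp _
  have hsum : mgf (∑ i, Y i) P (-t) = ∏ i, mgf (Y i) P (-t) := by
    simpa using hind.mgf_sum₀ hae Finset.univ
  have hint : Integrable (fun ω => Real.exp (-t * (∑ i, Y i) ω)) P := by
    refine Integrable.of_bound (C := 1) ?_ ?_
    · exact (Real.measurable_exp.comp_aemeasurable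
        ((Finset.aemeasurable_sum _ fun i _ => hae i).const_mul _)).aestronglyMeasurable
    · refine Filter.Eventually.of_forall fun ω => ?_
      rw [Real.norm_eq_abs, abs_of_pos (Real.exp_pos _), Real.exp_le_one_iff]
      have : 0 ≤ (∑ i, Y i) ω := by
        rw [Finset.sum_apply]; exact Finset.sum_nonneg fun i _ => h0 i ω
      nlinarith [mul_nonneg ht0 this]
  have key := measure_le_le_exp_mul_mgf (μ := P) (X := ∑ i, Y i) (k * ((1 - ε) * b))
    (t := -t) (by linarith) hint
  simp only [Finset.sum_apply] at key
  refine key.trans ?_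
  rw [hsum]
  calc Real.exp (-(-t) * (k * ((1 - ε) * b))) * ∏ i, mgf (Y i) P (-t)
      ≤ Real.exp (-(-t) * (k * ((1 - ε) * b))) *
          ∏ _i : Fin k, Real.exp (-t * b + t ^ 2 * M / 2) := by
        gcongr with i
        · exact fun i _ => mgf_nonneg
        · exact hmgf i
    _ = Real.exp (-(k * (ε ^ 2 * b ^ 2 / (2 * M)))) := by
        rw [Finset.prod_const, Finset.card_univ, Fintype.card_fin, ← Real.exp_nat_mul,
          ← Real.exp_add]
        congr 1
        rw [ht]
        field_simp
        ring

/-- Chernoff bound for the upper tail of a sum of independent variables. -/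
lemma measureReal_le_sum_of_mgf_le {Ω : Type*} [MeasurableSpace Ω] {P : Measure Ω}
    [IsProbabilityMeasure P] {k : ℕ} {Y : Fin k → Ω → ℝ} (hind : iIndepFun Y P)
    (hae : ∀ i, AEMeasurable (Y i) P) {t a A : ℝ} (ht : 0 ≤ t)
    (hint : ∀ i, Integrable (fun ω => Real.exp (t * Y i ω)) P)
    (hmgf : ∀ i, mgf (Y i) P t ≤ Real.exp A) :
    P.real {ω | k * a ≤ ∑ i, Y i ω} ≤ Real.exp (k * (A - t * a)) := by
  have hsum : mgf (∑ i, Y i) P t = ∏ i, mgf (Y i) P t := by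
    simpa using hind.mgf_sum₀ hae Finset.univ
  have hI : Integrable (fun ω => Real.exp (t * (∑ i, Y i) ω)) P := by
    -- A non-integrable exponential would have integral `0`, so a positive `mgf` forces
    -- integrability.
    rw [← mgf_pos_iff, hsum]
    exact Finset.prod_pos fun i _ => mgf_pos (hint i)
  have key := measure_ge_le_exp_mul_mgf (μ := P) (X := ∑ i, Y i) (k * a) (t := t) ht hI
  simp only [Finset.sum_apply] at key
  refine key.trans ?_
  rw [hsum]
  calc Real.exp (-t * (k * a)) * ∏ i, mgf (Y i) P t
      ≤ Real.exp (-t * (k * a)) * ∏ _i : Fin k, Real.exp A := by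
        gcongr with i
        · exact fun i _ => mgf_nonneg
        · exact hmgf i
    _ = Real.exp (k * (A - t * a)) := by
        rw [Finset.prod_const, Finset.card_univ, Fintype.card_fin, ← Real.exp_nat_mul,
          ← Real.exp_add]
        congr 1
        ring

lemma integrable_exp_mul_sq_gaussianReal {u : ℝ} (hu : u < 1 / 2) :
    Integrable (fun x => Real.exp (u * x ^ 2)) (gaussianReal 0 1) := by
  rw [gaussianReal_of_var_ne_zero _ one_ne_zero, gaussianPDF_def,
    integrable_withDensity_iff_integrable_smul' (by fun_prop) (by simp)]
  have h : Integrable (fun x : ℝ => (√(2 * Real.pi))⁻¹ * Real.exp (-(1 / 2 - u) * x ^ 2)) :=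
    (integrable_exp_neg_mul_sq (by linarith)).const_mul _
  refine h.congr (Filter.Eventually.of_forall fun x => ?_)
  simp only
  rw [ENNReal.toReal_ofReal (gaussianPDFReal_nonneg _ _ _), smul_eq_mul, gaussianPDFReal]
  simp only [NNReal.coe_one, mul_one, sub_zero]
  rw [mul_assoc, ← Real.exp_add]
  congr 2
  ring

lemma integral_exp_mul_sq_gaussianReal {u : ℝ} (hu : u < 1 / 2) :
    ∫ x, Real.exp (u * x ^ 2) ∂(gaussianReal 0 1) = (√(1 - 2 * u))⁻¹ := by
  rw [integral_gaussianReal_eq_integral_smul one_ne_zero]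
  have : ∀ x : ℝ, gaussianPDFReal 0 1 x • Real.exp (u * x ^ 2) =
      (√(2 * Real.pi))⁻¹ * Real.exp (-(1 / 2 - u) * x ^ 2) := by
    intro x
    rw [smul_eq_mul, gaussianPDFReal]
    simp only [NNReal.coe_one, mul_one, sub_zero]
    rw [mul_assoc, ← Real.exp_add]
    congr 2
    ring
  simp_rw [this]
  rw [integral_const_mul, integral_gaussian, ← Real.sqrt_inv, ← Real.sqrt_inv, ← Real.sqrt_mul]
  · congr 1
    have : (1 - 2 * u) ≠ 0 := by linarith
    have : (1 / 2 - u) ≠ 0 := by linarith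
    have := Real.pi_ne_zero
    field_simp
  · positivity

lemma inv_sqrt_le_exp {u : ℝ} (h0 : 0 ≤ u) (hu : u ≤ 1 / 4) :
    (√(1 - 2 * u))⁻¹ ≤ Real.exp (u + 2 * u ^ 2) := by
  have h1 : 0 < 1 - 2 * u := by linarith
  rw [inv_le_iff_one_le_mul₀ (Real.sqrt_pos.2 h1)]
  have h2 : 1 ≤ (Real.exp (u + 2 * u ^ 2) * √(1 - 2 * u)) ^ 2 := by
    rw [mul_pow, Real.sq_sqrt h1.le, ← Real.exp_nat_mul]
    have := Real.quadratic_le_exp_of_nonneg (x := ((2 : ℕ) : ℝ) * (u + 2 * u ^ 2)) (by positivity)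
    push_cast at this ⊢
    have h3 : 1 ≤ (1 + 2 * (u + 2 * u ^ 2) + (2 * (u + 2 * u ^ 2)) ^ 2 / 2) * (1 - 2 * u) := by
      have : 0 ≤ u ^ 2 * (1 / 4 - u) := mul_nonneg (sq_nonneg u) (by linarith)
      have h5 : 0 ≤ u ^ 2 * (1 / 4 - u) * u := mul_nonneg this h0
      have h6 : 0 ≤ u ^ 2 * (1 / 4 - u) * u ^ 2 := mul_nonneg this (sq_nonneg u)
      nlinarith [sq_nonneg u, pow_nonneg h0 3]
    exact h3.trans (mul_le_mul_of_nonneg_right this h1.le)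
  have h4 : 0 ≤ Real.exp (u + 2 * u ^ 2) * √(1 - 2 * u) := by positivity
  nlinarith

lemma memLp_id_gaussianReal_nat (v : ℝ≥0) (m : ℕ) :
    MemLp (fun x : ℝ => x) m (gaussianReal 0 v) :=
  memLp_id_gaussianReal' (m : ENNReal) (by simp)

lemma integral_sq_gaussianReal : ∫ x, x ^ 2 ∂(gaussianReal 0 1) = 1 := by
  have h := variance_fun_id_gaussianReal (μ := 0) (v := 1)
  rw [variance_of_integral_eq_zero (by fun_prop) (by simp)] at h
  simpa using h

lemma integral_pow_four_gaussianReal_le : ∫ x, x ^ 4 ∂(gaussianReal 0 1) ≤ 48 := by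
  calc ∫ x, x ^ 4 ∂(gaussianReal 0 1)
      ≤ ∫ x, 32 * Real.exp (1 / 4 * x ^ 2) ∂(gaussianReal 0 1) := by
        -- From `exp y ≥ y²/2` at `y = x²/4`. The constant `48` is `32√2` rounded up; the exact
        -- moment `3` is not needed.
        refine integral_mono_of_nonneg (Filter.Eventually.of_forall fun x => by positivity)
          ((integrable_exp_mul_sq_gaussianReal (by norm_num)).const_mul _)
          (Filter.Eventually.of_forall fun x => ?_)
        have := Real.quadratic_le_exp_of_nonneg (x := 1 / 4 * x ^ 2) (by positivity)
        simp only
        nlinarith [sq_nonneg x]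
    _ = 32 * (√(1 - 2 * (1 / 4)))⁻¹ := by
        rw [integral_const_mul, integral_exp_mul_sq_gaussianReal (by norm_num)]
    _ ≤ 48 := by
        have h : (2 / 3 : ℝ) ≤ √(1 - 2 * (1 / 4)) := Real.le_sqrt_of_sq_le (by norm_num)
        have := inv_anti₀ (by norm_num) h
        norm_num at this ⊢
        linarith

end StableRank

/-! ### Gaussian vectors, their linear functionals, and the rows of `W`. -/

namespace StableRank

/-- The law of a vector with i.i.d. centred Gaussian coordinates of variance `v`. -/
noncomputable def gaussVec (d : ℕ) (v : ℝ≥0) : Measure (Fin d → ℝ) :=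
  Measure.pi fun _ => gaussianReal 0 v

variable {d : ℕ} {v : ℝ≥0}

instance : IsProbabilityMeasure (gaussVec d v) := by
  unfold gaussVec; infer_instance

lemma measurePreserving_eval_gaussVec (i : Fin d) :
    MeasurePreserving (fun w : Fin d → ℝ => w i) (gaussVec d v) (gaussianReal 0 v) :=
  measurePreserving_eval (fun _ : Fin d => gaussianReal 0 v) i

lemma iIndepFun_eval_gaussVec : iIndepFun (fun i (w : Fin d → ℝ) => w i) (gaussVec d v) :=
  iIndepFun_pi (μ := fun _ : Fin d => gaussianReal 0 v) (X := fun _ x => x)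
    fun _ => aemeasurable_id

instance : IsGaussian (gaussVec d v) := by
  have h : HasGaussianLaw (fun (w : Fin d → ℝ) i => w i) (gaussVec d v) :=
    iIndepFun_eval_gaussVec.hasGaussianLaw fun i =>
      HasLaw.hasGaussianLaw (μ := gaussianReal 0 v)
        ⟨(measurable_pi_apply i).aemeasurable, (measurePreserving_eval_gaussVec i).map_eq⟩
  have := h.isGaussian_map
  rwa [show (fun (w : Fin d → ℝ) i => w i) = id from rfl, Measure.map_id] at this

lemma memLp_eval_gaussVec (i : Fin d) (m : ℕ) :
    MemLp (fun w : Fin d → ℝ => w i) m (gaussVec d v) :=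
  (memLp_id_gaussianReal_nat v m).comp_measurePreserving (measurePreserving_eval_gaussVec i)

lemma integral_eval_gaussVec (i : Fin d) : ∫ w, w i ∂(gaussVec d v) = 0 := by
  have h := (measurePreserving_eval_gaussVec (v := v) i).map_eq
  have h2 : ∫ x, x ∂((gaussVec d v).map fun w : Fin d → ℝ => w i) = ∫ w, w i ∂(gaussVec d v) :=
    integral_map (measurable_pi_apply i).aemeasurable (by fun_prop)
  rw [← h2, h, integral_id_gaussianReal]

lemma integral_eval_mul_eval_gaussVec (i j : Fin d) :
    ∫ w, w i * w j ∂(gaussVec d v) = if i = j then (v : ℝ) else 0 := by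
  split_ifs with hij
  · subst hij
    have h := (measurePreserving_eval_gaussVec (v := v) i).map_eq
    have h2 : ∫ x, x * x ∂((gaussVec d v).map fun w : Fin d → ℝ => w i) =
        ∫ w, w i * w i ∂(gaussVec d v) :=
      integral_map (measurable_pi_apply i).aemeasurable (by fun_prop)
    rw [← h2, h]
    have h3 := variance_fun_id_gaussianReal (μ := 0) (v := v)
    rw [variance_of_integral_eq_zero (by fun_prop) (by simp)] at h3
    simpa [sq] using h3
  · have := (iIndepFun_eval_gaussVec (v := v) (d := d)).indepFun hij
    rw [this.integral_fun_mul_eq_mul_integral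
      (measurable_pi_apply i).aestronglyMeasurable (measurable_pi_apply j).aestronglyMeasurable,
      integral_eval_gaussVec, zero_mul]

lemma integral_id_gaussVec : ∫ w, id w ∂(gaussVec d v) = 0 := by
  ext i
  have : (∫ w, id w ∂(gaussVec d v)) i = ∫ w, w i ∂(gaussVec d v) :=
    eval_integral (f := fun w : Fin d → ℝ => w)
      (fun j => (memLp_eval_gaussVec j 1).integrable (by simp)) i
  rw [this, integral_eval_gaussVec]
  rfl

lemma dotProduct_self_nonneg_real (a : Fin d → ℝ) : 0 ≤ a ⬝ᵥ a :=
  Finset.sum_nonneg fun i _ => mul_self_nonneg (a i)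

lemma measurable_dotProduct (a : Fin d → ℝ) : Measurable fun w : Fin d → ℝ => a ⬝ᵥ w := by
  unfold dotProduct; fun_prop

lemma memLp_dotProduct (a : Fin d → ℝ) (m : ℕ) :
    MemLp (fun w => a ⬝ᵥ w) m (gaussVec d v) := by
  unfold dotProduct
  exact memLp_finsetSum _ fun i _ => (memLp_eval_gaussVec i m).const_mul _

lemma integral_dotProduct (a : Fin d → ℝ) : ∫ w, a ⬝ᵥ w ∂(gaussVec d v) = 0 := by
  unfold dotProduct
  rw [integral_finsetSum _ fun i _ =>
    ((memLp_eval_gaussVec i 1).integrable (by simp)).const_mul _]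
  simp [integral_const_mul, integral_eval_gaussVec]

lemma integral_dotProduct_mul (a b : Fin d → ℝ) :
    ∫ w, (a ⬝ᵥ w) * (b ⬝ᵥ w) ∂(gaussVec d v) = v * (a ⬝ᵥ b) := by
  have hint : ∀ i j : Fin d, Integrable (fun w : Fin d → ℝ => (a i * w i) * (b j * w j))
      (gaussVec d v) := fun i j =>
    MemLp.integrable_mul (p := 2) (q := 2) ((memLp_eval_gaussVec i 2).const_mul _)
      ((memLp_eval_gaussVec j 2).const_mul _)
  unfold dotProduct
  simp_rw [Finset.sum_mul_sum]
  rw [integral_finsetSum _ fun i _ => integrable_finsetSum _ fun j _ => hint i j]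
  simp_rw [integral_finsetSum _ fun j _ => hint _ j]
  rw [Finset.mul_sum]
  refine Finset.sum_congr rfl fun i _ => ?_
  rw [Finset.sum_eq_single i]
  · have : ∀ w : Fin d → ℝ, a i * w i * (b i * w i) = a i * b i * (w i * w i) := fun w => by ring
    simp_rw [this]
    rw [integral_const_mul, integral_eval_mul_eval_gaussVec, if_pos rfl]
    ring
  · intro j _ hj
    have : ∀ w : Fin d → ℝ, a i * w i * (b j * w j) = a i * b j * (w i * w j) := fun w => by ring
    simp_rw [this]
    rw [integral_const_mul, integral_eval_mul_eval_gaussVec, if_neg hj.symm, mul_zero]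
  · simp

/-- `a ⬝ᵥ w` as a continuous linear functional of `w`. -/
noncomputable def dotCLM (a : Fin d → ℝ) : (Fin d → ℝ) →L[ℝ] ℝ :=
  ∑ i, a i • ContinuousLinearMap.proj i

lemma dotCLM_apply (a w : Fin d → ℝ) : dotCLM a w = a ⬝ᵥ w := by
  simp [dotCLM, dotProduct]

/-- A linear functional of a centred Gaussian vector is determined by its variance. Writing its law
as that of `sγ` matches the integrals defining `hermiteCoeff`. -/
lemma map_dotProduct_gaussVec (a : Fin d → ℝ) {s : ℝ} (hs : s ^ 2 = v * (a ⬝ᵥ a)) :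
    (gaussVec d v).map (fun w => a ⬝ᵥ w) = (gaussianReal 0 1).map (s * ·) := by
  have h : HasGaussianLaw (fun w => a ⬝ᵥ w) (gaussVec d v) := by
    have := (IsGaussian.hasGaussianLaw_id (μ := gaussVec d v)).map_fun (dotCLM a)
    simpa [dotCLM_apply] using this
  have hvar : Var[fun w => a ⬝ᵥ w; gaussVec d v] = s ^ 2 := by
    rw [variance_of_integral_eq_zero (measurable_dotProduct a).aemeasurable
      (integral_dotProduct a), hs, ← integral_dotProduct_mul]
    simp [sq]
  rw [h.map_eq_gaussianReal, gaussianReal_map_const_mul, integral_dotProduct, hvar]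
  congr 1
  · simp
  · ext
    simp [sq_nonneg]

lemma integral_comp_dotProduct (a : Fin d → ℝ) {s : ℝ} (hs : s ^ 2 = v * (a ⬝ᵥ a))
    {g : ℝ → ℝ} (hg : Measurable g) :
    ∫ w, g (a ⬝ᵥ w) ∂(gaussVec d v) = ∫ x, g (s * x) ∂(gaussianReal 0 1) := by
  rw [← integral_map (φ := fun w : Fin d → ℝ => a ⬝ᵥ w) (measurable_dotProduct a).aemeasurable
      hg.aestronglyMeasurable, map_dotProduct_gaussVec a hs,
    integral_map (by fun_prop) hg.aestronglyMeasurable]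

lemma integrable_comp_dotProduct (a : Fin d → ℝ) {s : ℝ} (hs : s ^ 2 = v * (a ⬝ᵥ a))
    {g : ℝ → ℝ} (hg : Measurable g) :
    Integrable (fun w => g (a ⬝ᵥ w)) (gaussVec d v) ↔
      Integrable (fun x => g (s * x)) (gaussianReal 0 1) := by
  have h1 := integrable_map_measure (μ := gaussVec d v) (f := fun w : Fin d → ℝ => a ⬝ᵥ w) (g := g)
    hg.aestronglyMeasurable (measurable_dotProduct a).aemeasurable
  have h2 := integrable_map_measure (μ := gaussianReal 0 1) (f := fun x : ℝ => s * x) (g := g)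
    hg.aestronglyMeasurable (by fun_prop)
  rw [map_dotProduct_gaussVec a hs] at h1
  exact h1.symm.trans h2

lemma integral_dotProduct_pow_four_le (a : Fin d → ℝ) :
    ∫ w, (a ⬝ᵥ w) ^ 4 ∂(gaussVec d v) ≤ 48 * (v * (a ⬝ᵥ a)) ^ 2 := by
  have h0 : 0 ≤ v * (a ⬝ᵥ a) := mul_nonneg v.2 (dotProduct_self_nonneg_real a)
  have hs : √(v * (a ⬝ᵥ a)) ^ 2 = v * (a ⬝ᵥ a) := Real.sq_sqrt h0
  rw [integral_comp_dotProduct a hs (g := fun x => x ^ 4) (by fun_prop)]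
  have hpow : ∀ x : ℝ, (√(v * (a ⬝ᵥ a)) * x) ^ 4 = √(v * (a ⬝ᵥ a)) ^ 4 * x ^ 4 :=
    fun x => mul_pow _ _ _
  simp_rw [hpow]
  rw [integral_const_mul, show √(v * (a ⬝ᵥ a)) ^ 4 = (√(v * (a ⬝ᵥ a)) ^ 2) ^ 2 by ring, hs,
    mul_comm]
  exact mul_le_mul_of_nonneg_right integral_pow_four_gaussianReal_le (sq_nonneg _)

/-- For a centred Gaussian vector, projecting `b ⬝ᵥ w` to the span of `a ⬝ᵥ w` does not change
its correlation with functions of `a ⬝ᵥ w`. -/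
lemma integral_comp_dotProduct_mul (a b : Fin d → ℝ) (ha : a ⬝ᵥ a ≠ 0) {g : ℝ → ℝ}
    (hg : Measurable g) (hL : MemLp (fun w => g (a ⬝ᵥ w)) 2 (gaussVec d v)) :
    ∫ w, g (a ⬝ᵥ w) * (b ⬝ᵥ w) ∂(gaussVec d v) =
      (a ⬝ᵥ b) / (a ⬝ᵥ a) * ∫ w, g (a ⬝ᵥ w) * (a ⬝ᵥ w) ∂(gaussVec d v) := by
  set r := (a ⬝ᵥ b) / (a ⬝ᵥ a) with hr
  -- The part of `b` orthogonal to `a`: `z ⬝ᵥ w` is jointly Gaussian and uncorrelated with `a ⬝ᵥ w`,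
  -- hence independent of it, and being centred it contributes nothing.
  set z : Fin d → ℝ := b - r • a with hz
  have haz : a ⬝ᵥ z = 0 := by
    rw [hz, dotProduct_sub, dotProduct_smul, smul_eq_mul, hr, div_mul_cancel₀ _ ha, sub_self]
  have hG : HasGaussianLaw (fun w => (a ⬝ᵥ w, z ⬝ᵥ w)) (gaussVec d v) := by
    have := (IsGaussian.hasGaussianLaw_id (μ := gaussVec d v)).map_fun
      ((dotCLM a).prod (dotCLM z))
    simpa [dotCLM_apply] using this
  have hind : IndepFun (fun w => a ⬝ᵥ w) (fun w => z ⬝ᵥ w) (gaussVec d v) := by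
    refine hG.indepFun_of_covariance_eq_zero ?_
    rw [covariance_eq_sub (memLp_dotProduct a 2) (memLp_dotProduct z 2)]
    simp only [Pi.mul_apply]
    rw [integral_dotProduct_mul, integral_dotProduct, haz]
    simp
  have hind2 : IndepFun (fun w => g (a ⬝ᵥ w)) (fun w => z ⬝ᵥ w) (gaussVec d v) :=
    hind.comp hg measurable_id
  have hzero : ∫ w, g (a ⬝ᵥ w) * (z ⬝ᵥ w) ∂(gaussVec d v) = 0 := by
    rw [hind2.integral_fun_mul_eq_mul_integral hL.aestronglyMeasurable
      (measurable_dotProduct z).aestronglyMeasurable, integral_dotProduct, mul_zero]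
  have hsplit : ∀ w : Fin d → ℝ, g (a ⬝ᵥ w) * (b ⬝ᵥ w) =
      g (a ⬝ᵥ w) * (z ⬝ᵥ w) + r * (g (a ⬝ᵥ w) * (a ⬝ᵥ w)) := by
    intro w
    rw [hz, sub_dotProduct, smul_dotProduct, smul_eq_mul]
    ring
  simp_rw [hsplit]
  have hint : ∀ y : Fin d → ℝ, Integrable (fun w => g (a ⬝ᵥ w) * (y ⬝ᵥ w)) (gaussVec d v) :=
    fun y => MemLp.integrable_mul (p := 2) (q := 2) hL (memLp_dotProduct y 2)
  rw [integral_add (hint z) ((hint a).const_mul r), hzero, integral_const_mul,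
    zero_add]

/-- The rows of a Gaussian matrix are independent Gaussian vectors. -/
lemma IsGaussianMatrix.hasLaw_row {Ω : Type*} [MeasurableSpace Ω] {P : Measure Ω} {k : ℕ}
    {W : Ω → Matrix (Fin k) (Fin d) ℝ} (hW : IsGaussianMatrix P W) (i : Fin k) :
    HasLaw (fun ω => W ω i) (gaussVec d (d : ℝ≥0)⁻¹) P := by
  have := hW.indep.isProbabilityMeasure
  have h : iIndepFun (fun j ω => W ω i j) P :=
    hW.indep.precomp (g := fun j => (i, j)) fun a b hab => by simpa using hab
  exact h.hasLaw_pi fun j => hW.law i j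

/-- All entries are jointly Gaussian, so independence of the rows reduces to vanishing covariances
between entries of different rows. -/
lemma IsGaussianMatrix.iIndepFun_row {Ω : Type*} [MeasurableSpace Ω] {P : Measure Ω} {k : ℕ}
    {W : Ω → Matrix (Fin k) (Fin d) ℝ} (hW : IsGaussianMatrix P W) :
    iIndepFun (fun i ω => W ω i) P := by
  have := hW.indep.isProbabilityMeasure
  have hL : ∀ i j, MemLp (fun ω => W ω i j) 2 P := fun i j =>
    (hW.law i j).hasGaussianLaw.memLp_two
  have h1 : HasGaussianLaw (fun ω (ij : Fin k × Fin d) => W ω ij.1 ij.2) P :=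
    hW.indep.hasGaussianLaw fun ij => (hW.law ij.1 ij.2).hasGaussianLaw
  have h2 : HasGaussianLaw (fun ω (i : Fin k) (j : Fin d) => W ω i j) P :=
    h1.map_fun (ContinuousLinearMap.pi fun i => ContinuousLinearMap.pi fun j =>
      ContinuousLinearMap.proj (R := ℝ) (φ := fun _ : Fin k × Fin d => ℝ) (i, j))
  refine h2.iIndepFun_of_covariance_eval (X := fun i j ω => W ω i j) fun i i' hne j j' => ?_
  exact (hW.indep.indepFun (i := (i, j)) (j := (i', j')) (by simp [hne])).covariance_eq_zero
    (hL i j) (hL i' j')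

end StableRank

/-! ### The rotation argument for two independent Gaussian copies. -/

namespace StableRank

lemma integrable_pow_four {α : Type*} [MeasurableSpace α] {μ : Measure α} {g : α → ℝ}
    (hg : MemLp g 4 μ) : Integrable (fun x => g x ^ 4) μ := by
  have := hg.integrable_norm_pow (p := 4) (by norm_num)
  simpa [Even.pow_abs (show Even 4 by decide)] using this

lemma sum_pow_four_le {N : ℕ} (a : ℕ → ℝ) :
    (∑ i ∈ Finset.range N, a i) ^ 4 ≤ (N : ℝ) ^ 3 * ∑ i ∈ Finset.range N, a i ^ 4 := by
  have h1 := sq_sum_le_card_mul_sum_sq (s := Finset.range N) (f := a)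
  have h2 := sq_sum_le_card_mul_sum_sq (s := Finset.range N) (f := fun i => a i ^ 2)
  rw [Finset.card_range] at h1 h2
  have h3 : ∀ i, (a i ^ 2) ^ 2 = a i ^ 4 := fun i => by ring
  simp_rw [h3] at h2
  calc (∑ i ∈ Finset.range N, a i) ^ 4 = ((∑ i ∈ Finset.range N, a i) ^ 2) ^ 2 := by ring
    _ ≤ (N * ∑ i ∈ Finset.range N, a i ^ 2) ^ 2 := by
        gcongr
    _ = (N : ℝ) ^ 2 * (∑ i ∈ Finset.range N, a i ^ 2) ^ 2 := by ring
    _ ≤ (N : ℝ) ^ 2 * (N * ∑ i ∈ Finset.range N, a i ^ 4) := by gcongr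
    _ = _ := by ring

section Rotation

variable {E : Type*} [NormedAddCommGroup E] [NormedSpace ℝ E] [MeasurableSpace E] [BorelSpace E]
  [SecondCountableTopology E] [CompleteSpace E] {μ : Measure E} [IsGaussian μ]

open scoped Real

lemma measurePreserving_rotation (hμ : ∫ x, id x ∂μ = 0) (θ : ℝ) :
    MeasurePreserving (ContinuousLinearMap.rotation (E := E) θ) (μ.prod μ) (μ.prod μ) :=
  ⟨by fun_prop, IsGaussian.map_rotation_eq_self hμ θ⟩

lemma memLp_comp_rotation (hμ : ∫ x, id x ∂μ = 0) {f : E → ℝ} {p : ENNReal} (hL : MemLp f p μ)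
    (θ : ℝ) :
    MemLp (fun x : E × E => f (Real.cos θ • x.1 + Real.sin θ • x.2)) p (μ.prod μ) := by
  have h1 : MemLp (fun x : E × E => f x.1) p (μ.prod μ) :=
    hL.comp_measurePreserving measurePreserving_fst
  exact h1.comp_measurePreserving (measurePreserving_rotation hμ θ)

/-- Splitting the rotation taking `x.1` to `x.2` into `N` equal steps, all of which have the same
law. -/
lemma integral_sub_pow_four_le_rotation (hμ : ∫ x, id x ∂μ = 0) {f : E → ℝ} (hL : MemLp f 4 μ)
    {N : ℕ} (hN : N ≠ 0) :
    ∫ x, (f x.1 - f x.2) ^ 4 ∂(μ.prod μ) ≤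
      ∫ x : E × E, ((N : ℝ) * (f (Real.cos (π / 2 / N) • x.1 + Real.sin (π / 2 / N) • x.2)
        - f x.1)) ^ 4 ∂(μ.prod μ) := by
  set δ : ℝ := π / 2 / N with hδ
  set h : ℝ → E × E → ℝ := fun θ x => f (Real.cos θ • x.1 + Real.sin θ • x.2) with hh
  have hN' : (N : ℝ) ≠ 0 := by exact_mod_cast hN
  have hmem : ∀ θ, MemLp (h θ) 4 (μ.prod μ) := memLp_comp_rotation hμ hL
  have hint : ∀ θ θ', Integrable (fun x => (h θ x - h θ' x) ^ 4) (μ.prod μ) := fun θ θ' =>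
    integrable_pow_four ((hmem θ).sub (hmem θ'))
  have hrot : ∀ θ θ' x, h θ (ContinuousLinearMap.rotation θ' x) = h (θ' + θ) x := by
    intro θ θ' x
    simp only [hh, ContinuousLinearMap.rotation_apply, Real.cos_add, Real.sin_add]
    congr 1
    module
  -- Precomposing with the rotation by `θ` shifts both angles by `θ` and preserves the product law.
  have hstep : ∀ θ, ∫ x, (h (θ + δ) x - h θ x) ^ 4 ∂(μ.prod μ) =
      ∫ x, (h δ x - h 0 x) ^ 4 ∂(μ.prod μ) := by
    intro θ
    have hmp := measurePreserving_rotation hμ θ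
    have : AEStronglyMeasurable (fun x => (h δ x - h 0 x) ^ 4)
        ((μ.prod μ).map (ContinuousLinearMap.rotation (E := E) θ)) := by
      rw [hmp.map_eq]; exact (hint δ 0).aestronglyMeasurable
    rw [← hmp.map_eq, integral_map hmp.measurable.aemeasurable this, hmp.map_eq]
    simp only [hrot, add_zero]
  have htel : ∀ x, f x.2 - f x.1 =
      ∑ i ∈ Finset.range N, (h (i * δ + δ) x - h (i * δ) x) := by
    intro x
    have := Finset.sum_range_sub (fun i : ℕ => h (i * δ) x) N
    simp only [Nat.cast_add, Nat.cast_one, add_mul, one_mul, Nat.cast_zero, zero_mul] at this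
    rw [this, hδ, mul_div_cancel₀ _ hN']
    simp [hh]
  calc ∫ x, (f x.1 - f x.2) ^ 4 ∂(μ.prod μ)
      = ∫ x, (∑ i ∈ Finset.range N, (h (i * δ + δ) x - h (i * δ) x)) ^ 4 ∂(μ.prod μ) := by
        refine integral_congr_ae (Filter.Eventually.of_forall fun x => ?_)
        simp only
        rw [← htel]
        ring
    _ ≤ ∫ x, (N : ℝ) ^ 3 * ∑ i ∈ Finset.range N, (h (i * δ + δ) x - h (i * δ) x) ^ 4
          ∂(μ.prod μ) := by
        refine integral_mono_of_nonneg (Filter.Eventually.of_forall fun x => ?_)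
          ((integrable_finsetSum _ fun i _ => hint _ _).const_mul _)
          (Filter.Eventually.of_forall fun x => sum_pow_four_le _)
        simp only [Pi.zero_apply]
        positivity
    -- The power mean inequality costs `N³` and the `N` equidistributed increments give one more
    -- `N`; `N⁴` turns the increment into a difference quotient.
    _ = (N : ℝ) ^ 4 * ∫ x, (h δ x - h 0 x) ^ 4 ∂(μ.prod μ) := by
        rw [integral_const_mul, integral_finsetSum _ fun i _ => hint _ _]
        simp_rw [hstep]
        rw [Finset.sum_const, Finset.card_range, nsmul_eq_mul]
        ring
    _ = _ := by
        rw [← integral_const_mul]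
        refine integral_congr_ae (Filter.Eventually.of_forall fun x => ?_)
        simp [hh, mul_pow]

end Rotation

/-! ### Differentiating a one-layer network along a rotation. -/

section Feature

variable {d n : ℕ} {v : ℝ≥0} {σ : ℝ → ℝ}

/-- The value at `w` of the network with one hidden layer `w ↦ σ(wX)` and output weights `u`. -/
noncomputable def feature (σ : ℝ → ℝ) (X : Matrix (Fin d) (Fin n) ℝ) (u : Fin n → ℝ)
    (w : Fin d → ℝ) : ℝ :=
  ∑ j, u j * σ (X.col j ⬝ᵥ w)

lemma memLp_comp_of_abs_le {α : Type*} [MeasurableSpace α] {μ : Measure α} {g : α → ℝ}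
    {p : ENNReal} (hσ : Continuous σ) (h0 : ∀ t, |σ t| ≤ |t|) (hg : MemLp g p μ) :
    MemLp (fun x => σ (g x)) p μ :=
  hg.mono (hσ.comp_aestronglyMeasurable hg.aestronglyMeasurable)
    (Filter.Eventually.of_forall fun x => h0 (g x))

lemma memLp_feature (hσ : Continuous σ) (h0 : ∀ t, |σ t| ≤ |t|) (X : Matrix (Fin d) (Fin n) ℝ)
    (u : Fin n → ℝ) (m : ℕ) : MemLp (feature σ X u) m (gaussVec d v) :=
  memLp_finsetSum _ fun j _ =>
    (memLp_comp_of_abs_le hσ h0 (memLp_dotProduct (X.col j) m)).const_mul _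

lemma hasDerivAt_comp_rotation {a b : ℝ} (ha : DifferentiableAt ℝ σ a) :
    HasDerivAt (fun t => σ (Real.cos t * a + Real.sin t * b)) (deriv σ a * b) 0 := by
  have h1 : HasDerivAt (fun t => Real.cos t * a + Real.sin t * b) b 0 := by
    have := ((Real.hasDerivAt_cos 0).mul_const a).fun_add
      ((Real.hasDerivAt_sin 0).mul_const b)
    simpa using this
  have h2 : HasDerivAt σ (deriv σ a) (Real.cos 0 * a + Real.sin 0 * b) := by
    simpa using ha.hasDerivAt
  exact h2.comp (0 : ℝ) h1

/-- The derivative of `feature σ X u` at `x.1` in the direction `x.2`. -/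
noncomputable def featureDeriv (σ : ℝ → ℝ) (X : Matrix (Fin d) (Fin n) ℝ) (u : Fin n → ℝ)
    (x : (Fin d → ℝ) × (Fin d → ℝ)) : ℝ :=
  ∑ j, u j * (deriv σ (X.col j ⬝ᵥ x.1) * (X.col j ⬝ᵥ x.2))

/-- Lipschitz functions on the line are differentiable Lebesgue-a.e., and the law of `a ⬝ᵥ w` is a
nondegenerate Gaussian. This is where nonzero columns matter for the concentration argument. -/
lemma ae_differentiableAt_dotProduct (hσ : LipschitzWith 1 σ) (hv : v ≠ 0) {a : Fin d → ℝ}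
    (ha : a ⬝ᵥ a ≠ 0) : ∀ᵐ w ∂(gaussVec d v), DifferentiableAt ℝ σ (a ⬝ᵥ w) := by
  set s := √(v * (a ⬝ᵥ a)) with hs
  have h0 : 0 < v * (a ⬝ᵥ a) :=
    mul_pos (NNReal.coe_pos.2 (pos_iff_ne_zero.2 hv)) ((dotProduct_self_nonneg_real a).lt_of_ne' ha)
  have hs2 : s ^ 2 = v * (a ⬝ᵥ a) := Real.sq_sqrt h0.le
  have hae : ∀ᵐ x ∂((gaussVec d v).map fun w => a ⬝ᵥ w), DifferentiableAt ℝ σ x := by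
    rw [map_dotProduct_gaussVec a hs2, gaussianReal_map_const_mul]
    refine (gaussianReal_absolutelyContinuous _ ?_).ae_le hσ.ae_differentiableAt_real
    rw [mul_one]
    intro h
    have := congrArg NNReal.toReal h
    simp only [NNReal.coe_mk, NNReal.coe_zero] at this
    rw [hs2] at this
    exact h0.ne' this
  exact ae_of_ae_map (measurable_dotProduct a).aemeasurable hae

/-- A difference quotient at angle `0` along the angles `π / (2(N+1))`; the shift to `N + 1` keeps
the step defined and nonzero. -/
lemma tendsto_feature_rotation {X : Matrix (Fin d) (Fin n) ℝ} {u : Fin n → ℝ}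
    {x : (Fin d → ℝ) × (Fin d → ℝ)} (hx : ∀ j, DifferentiableAt ℝ σ (X.col j ⬝ᵥ x.1)) :
    Filter.Tendsto (fun N : ℕ => ((N + 1 : ℕ) : ℝ) *
      (feature σ X u (Real.cos (Real.pi / 2 / (N + 1 : ℕ)) • x.1
        + Real.sin (Real.pi / 2 / (N + 1 : ℕ)) • x.2) - feature σ X u x.1))
      Filter.atTop (nhds (Real.pi / 2 * featureDeriv σ X u x)) := by
  have hd : HasDerivAt (fun t => feature σ X u (Real.cos t • x.1 + Real.sin t • x.2))
      (featureDeriv σ X u x) 0 := by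
    simp only [feature, featureDeriv, dotProduct_add, dotProduct_smul, smul_eq_mul]
    exact HasDerivAt.fun_sum fun j _ => (hasDerivAt_comp_rotation (hx j)).const_mul (u j)
  have hs := hd.tendsto_slope_zero
  have hδ : Filter.Tendsto (fun N : ℕ => Real.pi / 2 / ((N + 1 : ℕ) : ℝ)) Filter.atTop
      (nhdsWithin 0 {0}ᶜ) := by
    refine tendsto_nhdsWithin_iff.2 ⟨?_, Filter.Eventually.of_forall fun N => ?_⟩
    · exact (tendsto_const_div_atTop_nhds_zero_nat (Real.pi / 2)).comp
        (Filter.tendsto_add_atTop_nat 1)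
    · simp only [Set.mem_compl_iff, Set.mem_singleton_iff]
      have := Real.pi_pos
      positivity
  have := (hs.comp hδ).const_mul (Real.pi / 2)
  refine this.congr fun N => ?_
  have hp := Real.pi_ne_zero
  have hN : ((N + 1 : ℕ) : ℝ) ≠ 0 := by positivity
  simp only [Function.comp_apply, zero_add, Real.cos_zero, Real.sin_zero, one_smul, zero_smul,
    add_zero, smul_eq_mul]
  field_simp

/-- Supplies an `N`-free dominating function for the limit: `|sin δ|` and `|cos δ - 1|` are at most
`δ`, and `Nδ = π/2 ≤ 2`. -/
lemma abs_feature_rotation_le (hσ : LipschitzWith 1 σ) (X : Matrix (Fin d) (Fin n) ℝ)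
    (u : Fin n → ℝ) (x : (Fin d → ℝ) × (Fin d → ℝ)) {N : ℕ} (hN : N ≠ 0) :
    |(N : ℝ) * (feature σ X u (Real.cos (Real.pi / 2 / N) • x.1
        + Real.sin (Real.pi / 2 / N) • x.2) - feature σ X u x.1)| ≤
      ∑ j, |u j| * (2 * (|X.col j ⬝ᵥ x.1| + |X.col j ⬝ᵥ x.2|)) := by
  set δ := Real.pi / 2 / N with hδ
  have hN' : (0 : ℝ) < N := by exact_mod_cast Nat.pos_of_ne_zero hN
  have hδ0 : 0 ≤ δ := by have := Real.pi_pos; positivity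
  have hNδ : N * δ ≤ 2 := by
    rw [hδ, mul_div_cancel₀ _ hN'.ne']
    linarith [Real.pi_le_four]
  have hsin : |Real.sin δ| ≤ δ := (Real.abs_sin_le_abs).trans_eq (abs_of_nonneg hδ0)
  have hcos : |Real.cos δ - 1| ≤ δ := by
    simpa [abs_of_nonneg hδ0] using Real.abs_cos_sub_cos_le δ 0
  simp only [feature]
  rw [← Finset.sum_sub_distrib, Finset.mul_sum]
  refine (Finset.abs_sum_le_sum_abs _ _).trans (Finset.sum_le_sum fun j _ => ?_)
  set a := X.col j ⬝ᵥ x.1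
  set b := X.col j ⬝ᵥ x.2
  have hl : |σ (X.col j ⬝ᵥ (Real.cos δ • x.1 + Real.sin δ • x.2)) - σ a| ≤ δ * (|a| + |b|) := by
    have h1 := hσ.dist_le_mul (X.col j ⬝ᵥ (Real.cos δ • x.1 + Real.sin δ • x.2)) a
    rw [Real.dist_eq, Real.dist_eq, NNReal.coe_one, one_mul, dotProduct_add, dotProduct_smul,
      dotProduct_smul, smul_eq_mul, smul_eq_mul] at h1
    rw [dotProduct_add, dotProduct_smul, dotProduct_smul, smul_eq_mul, smul_eq_mul]
    refine h1.trans ?_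
    calc |Real.cos δ * a + Real.sin δ * b - a| = |(Real.cos δ - 1) * a + Real.sin δ * b| := by
          congr 1; ring
      _ ≤ |Real.cos δ - 1| * |a| + |Real.sin δ| * |b| := by
          rw [← abs_mul, ← abs_mul]; exact abs_add_le _ _
      _ ≤ δ * |a| + δ * |b| := by gcongr
      _ = _ := by ring
  rw [← mul_sub, abs_mul, abs_mul, abs_of_pos hN']
  calc (N : ℝ) * (|u j| * _) ≤ N * (|u j| * (δ * (|a| + |b|))) := by gcongr
    _ = |u j| * ((N * δ) * (|a| + |b|)) := by ring
    _ ≤ _ := by gcongr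

end Feature

end StableRank

/-! ### Fourth-moment concentration. -/

namespace StableRank

variable {d n : ℕ} {v : ℝ≥0} {σ : ℝ → ℝ}

lemma memLp_featureDeriv (hσ : LipschitzWith 1 σ) (X : Matrix (Fin d) (Fin n) ℝ) (u : Fin n → ℝ)
    (m : ℕ) : MemLp (featureDeriv σ X u) m ((gaussVec d v).prod (gaussVec d v)) := by
  refine memLp_finsetSum _ fun j _ => MemLp.const_mul ?_ _
  have h : MemLp (fun x : (Fin d → ℝ) × (Fin d → ℝ) => X.col j ⬝ᵥ x.2) m
      ((gaussVec d v).prod (gaussVec d v)) :=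
    (memLp_dotProduct (X.col j) m).comp_measurePreserving measurePreserving_snd
  refine h.mono ?_ (Filter.Eventually.of_forall fun x => ?_)
  · exact ((measurable_deriv σ).comp
      ((measurable_dotProduct (X.col j)).comp measurable_fst)).aestronglyMeasurable.mul
      h.aestronglyMeasurable
  · rw [norm_mul]
    refine mul_le_of_le_one_left (norm_nonneg _) ?_
    simpa using norm_deriv_le_of_lipschitz (x₀ := X.col j ⬝ᵥ x.1) hσ

/-- With `x.1` frozen, the derivative is a linear functional of the Gaussian `x.2`, so its
conditional moments are explicit. -/
lemma featureDeriv_eq_dotProduct (X : Matrix (Fin d) (Fin n) ℝ) (u : Fin n → ℝ)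
    (x : (Fin d → ℝ) × (Fin d → ℝ)) :
    featureDeriv σ X u x =
      X.mulVec (fun j => u j * deriv σ (X.col j ⬝ᵥ x.1)) ⬝ᵥ x.2 := by
  simp only [featureDeriv, dotProduct, Matrix.mulVec, Matrix.col_apply, Finset.mul_sum,
    Finset.sum_mul]
  rw [Finset.sum_comm]
  refine Finset.sum_congr rfl fun i _ => Finset.sum_congr rfl fun j _ => ?_
  ring

lemma integral_featureDeriv_pow_four_le (hσ : LipschitzWith 1 σ) {X : Matrix (Fin d) (Fin n) ℝ}
    {u : Fin n → ℝ} (hu : u ⬝ᵥ u ≤ 1) {L : ℝ} (hL0 : 0 ≤ L)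
    (hL : ∀ y, X.mulVec y ⬝ᵥ X.mulVec y ≤ L * (y ⬝ᵥ y)) :
    ∫ x, featureDeriv σ X u x ^ 4 ∂((gaussVec d v).prod (gaussVec d v)) ≤ 48 * (v * L) ^ 2 := by
  rw [integral_prod _ (integrable_pow_four (memLp_featureDeriv hσ X u 4))]
  have hbd : ∀ w, ∫ w', featureDeriv σ X u (w, w') ^ 4 ∂(gaussVec d v) ≤ 48 * (v * L) ^ 2 := by
    intro w
    simp only [featureDeriv_eq_dotProduct]
    set y : Fin n → ℝ := fun j => u j * deriv σ (X.col j ⬝ᵥ w) with hy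
    refine (integral_dotProduct_pow_four_le _).trans ?_
    have h1 : y ⬝ᵥ y ≤ u ⬝ᵥ u := by
      refine Finset.sum_le_sum fun j _ => ?_
      -- Valid at every point, since `deriv` is `0` where `σ` is not differentiable.
      have h2 : |deriv σ (X.col j ⬝ᵥ w)| ≤ 1 := by
        simpa using norm_deriv_le_of_lipschitz (x₀ := X.col j ⬝ᵥ w) hσ
      have h3 : deriv σ (X.col j ⬝ᵥ w) ^ 2 ≤ 1 := (sq_le_one_iff_abs_le_one _).2 h2
      simp only [hy]
      nlinarith [mul_self_nonneg (u j)]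
    have h4 : X.mulVec y ⬝ᵥ X.mulVec y ≤ L := by
      refine (hL y).trans ?_
      nlinarith
    have h5 := dotProduct_self_nonneg_real (X.mulVec y)
    have h6 : (0 : ℝ) ≤ v := v.2
    gcongr
  calc _ ≤ ∫ _w, 48 * (v * L) ^ 2 ∂(gaussVec d v) := by
        refine integral_mono_of_nonneg (Filter.Eventually.of_forall fun w => ?_)
          (integrable_const _) (Filter.Eventually.of_forall hbd)
        exact integral_nonneg fun w' => by positivity
    _ = _ := by simp

/-- Concentration of a Lipschitz feature of a Gaussian vector, in fourth moment. -/
lemma integral_feature_sub_pow_four_le (hσ : LipschitzWith 1 σ) (h0 : ∀ t, |σ t| ≤ |t|)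
    (hv : v ≠ 0) {X : Matrix (Fin d) (Fin n) ℝ} (hX : ∀ j, X.col j ⬝ᵥ X.col j ≠ 0)
    {u : Fin n → ℝ} (hu : u ⬝ᵥ u ≤ 1) {L : ℝ} (hL0 : 0 ≤ L)
    (hL : ∀ y, X.mulVec y ⬝ᵥ X.mulVec y ≤ L * (y ⬝ᵥ y)) :
    ∫ x, (feature σ X u x.1 - feature σ X u x.2) ^ 4 ∂((gaussVec d v).prod (gaussVec d v)) ≤
      768 * (v * L) ^ 2 := by
  set μ := gaussVec d v with hμ
  set f := feature σ X u with hf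
  have hfL : MemLp f 4 μ := memLp_feature hσ.continuous h0 X u 4
  set F : ℕ → (Fin d → ℝ) × (Fin d → ℝ) → ℝ := fun N x => (((N + 1 : ℕ) : ℝ) *
      (f (Real.cos (Real.pi / 2 / (N + 1 : ℕ)) • x.1
        + Real.sin (Real.pi / 2 / (N + 1 : ℕ)) • x.2) - f x.1)) ^ 4 with hF
  set B : (Fin d → ℝ) × (Fin d → ℝ) → ℝ := fun x =>
    ∑ j, |u j| * (2 * (|X.col j ⬝ᵥ x.1| + |X.col j ⬝ᵥ x.2|)) with hB
  have hBL : MemLp B 4 (μ.prod μ) := by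
    have hdot : ∀ j, MemLp (fun w => |X.col j ⬝ᵥ w|) 4 μ := fun j =>
      MemLp.abs (by exact_mod_cast memLp_dotProduct (X.col j) 4)
    have h1 : ∀ j, MemLp (fun x : (Fin d → ℝ) × (Fin d → ℝ) => |X.col j ⬝ᵥ x.1|) 4 (μ.prod μ) :=
      fun j => (hdot j).comp_measurePreserving measurePreserving_fst
    have h2 : ∀ j, MemLp (fun x : (Fin d → ℝ) × (Fin d → ℝ) => |X.col j ⬝ᵥ x.2|) 4 (μ.prod μ) :=
      fun j => (hdot j).comp_measurePreserving measurePreserving_snd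
    exact memLp_finsetSum _ fun j _ => (((h1 j).add (h2 j)).const_mul 2).const_mul |u j|
  -- Letting the number of rotation steps tend to infinity replaces the increments by the
  -- derivative, whose bound involves only `L`.
  have hlim : Filter.Tendsto (fun N => ∫ x, F N x ∂(μ.prod μ)) Filter.atTop
      (nhds (∫ x, (Real.pi / 2 * featureDeriv σ X u x) ^ 4 ∂(μ.prod μ))) := by
    refine tendsto_integral_of_dominated_convergence (fun x => B x ^ 4) (fun N => ?_)
      (integrable_pow_four hBL) (fun N => Filter.Eventually.of_forall fun x => ?_) ?_
    · refine AEStronglyMeasurable.pow (AEStronglyMeasurable.const_mul ?_ _) 4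
      exact ((memLp_comp_rotation integral_id_gaussVec hfL _).aestronglyMeasurable).sub
        (hfL.comp_measurePreserving measurePreserving_fst).aestronglyMeasurable
    · rw [hF, norm_pow]
      exact pow_le_pow_left₀ (norm_nonneg _)
        (abs_feature_rotation_le hσ X u x (Nat.succ_ne_zero N)) 4
    · have hae : ∀ᵐ w ∂μ, ∀ j, DifferentiableAt ℝ σ (X.col j ⬝ᵥ w) :=
        ae_all_iff.2 fun j => ae_differentiableAt_dotProduct hσ hv (hX j)
      have hae2 : ∀ᵐ x ∂(μ.prod μ), ∀ j, DifferentiableAt ℝ σ (X.col j ⬝ᵥ x.1) :=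
        (measurePreserving_fst (μ := μ) (ν := μ)).quasiMeasurePreserving.ae hae
      filter_upwards [hae2] with x hx
      exact (tendsto_feature_rotation hx).pow 4
  have hle : ∫ x, (f x.1 - f x.2) ^ 4 ∂(μ.prod μ) ≤
      ∫ x, (Real.pi / 2 * featureDeriv σ X u x) ^ 4 ∂(μ.prod μ) :=
    ge_of_tendsto' hlim fun N =>
      integral_sub_pow_four_le_rotation integral_id_gaussVec hfL (Nat.succ_ne_zero N)
  refine hle.trans ?_
  simp only [mul_pow (Real.pi / 2)]
  rw [integral_const_mul]
  have hpi : (Real.pi / 2) ^ 4 ≤ 16 := by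
    have : Real.pi / 2 ≤ 2 := by linarith [Real.pi_le_four]
    calc (Real.pi / 2) ^ 4 ≤ 2 ^ 4 := by have := Real.pi_pos; gcongr
      _ = 16 := by norm_num
  calc (Real.pi / 2) ^ 4 * ∫ x, featureDeriv σ X u x ^ 4 ∂(μ.prod μ)
      ≤ 16 * (48 * (v * L) ^ 2) := by
        refine mul_le_mul hpi (integral_featureDeriv_pow_four_le hσ hu hL0 hL)
          (integral_nonneg fun x => by positivity) (by norm_num)
    _ = _ := by ring

/-- Either `|a| ≤ 2|b|`, and the second term suffices, or `|a - b| ≥ |a|/2`, and the first does. For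
independent copies the product `a²b²` integrates to the square of the second moment, so no centring
is needed. -/
lemma pow_four_le_sub_pow_four (a b : ℝ) : a ^ 4 ≤ 16 * (a - b) ^ 4 + 4 * (a ^ 2 * b ^ 2) := by
  by_cases h : a ^ 2 ≤ 4 * b ^ 2
  · nlinarith [mul_le_mul_of_nonneg_left h (sq_nonneg a), sq_nonneg ((a - b) ^ 2)]
  · push Not at h
    have h1 : a ^ 2 ≤ 4 * (a - b) ^ 2 := by
      have h2 : |2 * b| < |a| := by
        rw [← sq_lt_sq]; linarith
      have h3 : |a| ≤ |2 * (a - b)| := by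
        have : |2 * a| ≤ |2 * (a - b)| + |2 * b| := by
          have := abs_add_le (2 * (a - b)) (2 * b)
          rwa [show 2 * (a - b) + 2 * b = 2 * a by ring] at this
        rw [abs_mul 2 a, abs_of_pos (by norm_num : (0 : ℝ) < 2)] at this
        linarith
      have := sq_le_sq.2 h3
      linarith
    have h4 : (a ^ 2) ^ 2 ≤ (4 * (a - b) ^ 2) ^ 2 := pow_le_pow_left₀ (sq_nonneg a) h1 2
    nlinarith [mul_nonneg (sq_nonneg a) (sq_nonneg b)]

/-- Controls the second moment of `f²` by its squared mean and the Lipschitz scale, which is what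
the lower-tail Chernoff bound requires. Here `12288 = 16 · 768`. -/
lemma integral_feature_pow_four_le (hσ : LipschitzWith 1 σ) (h0 : ∀ t, |σ t| ≤ |t|)
    (hv : v ≠ 0) {X : Matrix (Fin d) (Fin n) ℝ} (hX : ∀ j, X.col j ⬝ᵥ X.col j ≠ 0)
    {u : Fin n → ℝ} (hu : u ⬝ᵥ u ≤ 1) {L : ℝ} (hL0 : 0 ≤ L)
    (hL : ∀ y, X.mulVec y ⬝ᵥ X.mulVec y ≤ L * (y ⬝ᵥ y)) :
    ∫ w, feature σ X u w ^ 4 ∂(gaussVec d v) ≤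
      12288 * (v * L) ^ 2 + 4 * (∫ w, feature σ X u w ^ 2 ∂(gaussVec d v)) ^ 2 := by
  set μ := gaussVec d v with hμ
  set f := feature σ X u with hf
  have hfL : MemLp f 4 μ := memLp_feature hσ.continuous h0 X u 4
  have hf2 : Integrable (fun w => f w ^ 2) μ :=
    (show MemLp f 2 μ from memLp_feature hσ.continuous h0 X u 2).integrable_sq
  have hd : MemLp (fun x : (Fin d → ℝ) × (Fin d → ℝ) => f x.1 - f x.2) 4 (μ.prod μ) :=
    (hfL.comp_measurePreserving measurePreserving_fst).sub
      (hfL.comp_measurePreserving measurePreserving_snd)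
  have h1 : ∫ w, f w ^ 4 ∂μ = ∫ x, f x.1 ^ 4 ∂(μ.prod μ) := by
    rw [integral_fun_fst (fun w => f w ^ 4)]
    simp
  have h2 : ∫ x, f x.1 ^ 2 * f x.2 ^ 2 ∂(μ.prod μ) = (∫ w, f w ^ 2 ∂μ) ^ 2 := by
    rw [integral_prod_mul (fun w => f w ^ 2) (fun w => f w ^ 2), sq]
  have hi1 := integrable_pow_four hd
  have hi2 : Integrable (fun x : (Fin d → ℝ) × (Fin d → ℝ) => f x.1 ^ 2 * f x.2 ^ 2) (μ.prod μ) :=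
    hf2.mul_prod hf2
  have h3 : ∫ x, f x.1 ^ 4 ∂(μ.prod μ) ≤
      16 * ∫ x, (f x.1 - f x.2) ^ 4 ∂(μ.prod μ) + 4 * ∫ x, f x.1 ^ 2 * f x.2 ^ 2 ∂(μ.prod μ) := by
    rw [← integral_const_mul, ← integral_const_mul,
      ← integral_add (hi1.const_mul _) (hi2.const_mul _)]
    refine integral_mono_of_nonneg (Filter.Eventually.of_forall fun x => ?_)
      ((hi1.const_mul _).add (hi2.const_mul _))
      (Filter.Eventually.of_forall fun x => pow_four_le_sub_pow_four _ _)
    simp only [Pi.zero_apply]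
    positivity
  rw [h1]
  rw [h2] at h3
  linarith [integral_feature_sub_pow_four_le hσ h0 hv hX hu hL0 hL]

end StableRank

/-! ### Frobenius and operator norms through dot products. -/

namespace StableRank

section Norms

variable {m n : ℕ}

lemma frobNorm_sq (A : Matrix (Fin m) (Fin n) ℝ) : frobNorm A ^ 2 = ∑ i, ∑ j, A i j ^ 2 := by
  have h0 : 0 ≤ ∑ i, ∑ j, A i j ^ 2 := by positivity
  unfold frobNorm
  rw [Matrix.frobenius_norm_def]
  simp only [Real.norm_eq_abs, Real.rpow_two, sq_abs]
  rw [← Real.sqrt_eq_rpow, Real.sq_sqrt h0]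

lemma frobNorm_sq_eq_sum_col (A : Matrix (Fin m) (Fin n) ℝ) :
    frobNorm A ^ 2 = ∑ j, A.col j ⬝ᵥ A.col j := by
  rw [frobNorm_sq, Finset.sum_comm]
  simp [dotProduct, sq]

lemma norm_toLp_sq (y : Fin n → ℝ) : ‖WithLp.toLp 2 y‖ ^ 2 = y ⬝ᵥ y := by
  rw [EuclideanSpace.norm_sq_eq]
  simp [dotProduct, sq]

lemma colNorm_sq (X : Matrix (Fin m) (Fin n) ℝ) (j : Fin n) :
    colNorm X j ^ 2 = X.col j ⬝ᵥ X.col j :=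
  norm_toLp_sq _

open scoped Matrix.Norms.L2Operator in
lemma mulVec_dotProduct_self_le (A : Matrix (Fin m) (Fin n) ℝ) (y : Fin n → ℝ) :
    A.mulVec y ⬝ᵥ A.mulVec y ≤ opNorm A ^ 2 * (y ⬝ᵥ y) := by
  have h := A.l2_opNorm_mulVec (WithLp.toLp 2 y)
  have h2 := pow_le_pow_left₀ (norm_nonneg _) h 2
  rw [mul_pow] at h2
  rw [← norm_toLp_sq, ← norm_toLp_sq]
  exact h2

open scoped Matrix.Norms.L2Operator in
-- Compactness of the closed unit ball, used instead of the sphere, which is empty when `n = 0`.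
lemma exists_opNorm_sq_eq (A : Matrix (Fin m) (Fin n) ℝ) :
    ∃ y : Fin n → ℝ, y ⬝ᵥ y ≤ 1 ∧ opNorm A ^ 2 ≤ A.mulVec y ⬝ᵥ A.mulVec y := by
  set T : EuclideanSpace ℝ (Fin n) →L[ℝ] EuclideanSpace ℝ (Fin m) :=
    (Matrix.toEuclideanLin (𝕜 := ℝ) (m := Fin m) (n := Fin n)).trans
      LinearMap.toContinuousLinearMap A with hT
  have hTA : ‖A‖ = ‖T‖ := Matrix.l2_opNorm_def A
  obtain ⟨y, hy, hmax⟩ := (isCompact_closedBall (0 : EuclideanSpace ℝ (Fin n)) 1).exists_isMaxOn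
    ⟨0, by simp⟩ (f := fun x => ‖T x‖) (by fun_prop)
  have hle : ‖T‖ ≤ ‖T y‖ := by
    refine T.opNorm_le_of_unit_norm (norm_nonneg _) fun x hx => ?_
    exact hmax (by simp [hx])
  have hTy : ‖T y‖ ^ 2 = A.mulVec (WithLp.ofLp y) ⬝ᵥ A.mulVec (WithLp.ofLp y) := by
    rw [← norm_toLp_sq]
    rfl
  refine ⟨WithLp.ofLp y, ?_, ?_⟩
  · rw [← norm_toLp_sq]
    have : ‖y‖ ≤ 1 := by simpa using hy
    exact pow_le_one₀ (norm_nonneg _) this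
  · rw [← hTy]
    unfold opNorm
    rw [hTA]
    exact pow_le_pow_left₀ (norm_nonneg _) hle 2

end Norms

/-! ### First and second moments of the squared row norm. -/

section SecondMoment

variable {σ : ℝ → ℝ}

/-- Cauchy–Schwarz in the form `∫ (f - cg)² ≥ 0`; the free `c` avoids dividing by the norm of `g`.
-/
lemma two_mul_integral_sub_le {α : Type*} [MeasurableSpace α] {μ : Measure α} {f g : α → ℝ}
    (hf : MemLp f 2 μ) (hg : MemLp g 2 μ) (c : ℝ) :
    2 * c * ∫ x, f x * g x ∂μ - c ^ 2 * ∫ x, g x ^ 2 ∂μ ≤ ∫ x, f x ^ 2 ∂μ := by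
  have hfg : Integrable (fun x => f x * g x) μ := MemLp.integrable_mul (p := 2) (q := 2) hf hg
  rw [← integral_const_mul, ← integral_const_mul,
    ← integral_sub (hfg.const_mul _) (hg.integrable_sq.const_mul _)]
  refine integral_mono ((hfg.const_mul _).sub (hg.integrable_sq.const_mul _)) hf.integrable_sq
    fun x => ?_
  simp only
  nlinarith [sq_nonneg (f x - c * g x)]

lemma hermiteCoeff_one (σ : ℝ → ℝ) (s : ℝ) :
    hermiteCoeff σ 1 s = ∫ x, σ (s * x) * x ∂(gaussianReal 0 1) := by
  simp [hermiteCoeff, orthoHermite]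

lemma memLp_comp_mul_gaussianReal (hσ : Continuous σ) (h0 : ∀ t, |σ t| ≤ |t|) (s : ℝ) :
    MemLp (fun x => σ (s * x)) 2 (gaussianReal 0 1) :=
  memLp_comp_of_abs_le hσ h0 ((memLp_id_gaussianReal_nat 1 2).const_mul s)

/-- Bessel's inequality for the unit vector `γ`. -/
lemma hermiteCoeff_one_sq_le (hσ : Continuous σ) (h0 : ∀ t, |σ t| ≤ |t|) (s : ℝ) :
    hermiteCoeff σ 1 s ^ 2 ≤ ∫ x, σ (s * x) ^ 2 ∂(gaussianReal 0 1) := by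
  have h := two_mul_integral_sub_le (memLp_comp_mul_gaussianReal hσ h0 s)
    (memLp_id_gaussianReal_nat 1 2) (hermiteCoeff σ 1 s)
  rw [← hermiteCoeff_one, integral_sq_gaussianReal] at h
  linarith

lemma integral_comp_mul_sq_le (hσ : Continuous σ) (h0 : ∀ t, |σ t| ≤ |t|) (s : ℝ) :
    ∫ x, σ (s * x) ^ 2 ∂(gaussianReal 0 1) ≤ s ^ 2 := by
  calc ∫ x, σ (s * x) ^ 2 ∂(gaussianReal 0 1) ≤ ∫ x, s ^ 2 * x ^ 2 ∂(gaussianReal 0 1) := by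
        refine integral_mono (memLp_comp_mul_gaussianReal hσ h0 s).integrable_sq
          ((show MemLp (fun x : ℝ => x) 2 (gaussianReal 0 1) from
            memLp_id_gaussianReal_nat 1 2).integrable_sq.const_mul _) fun x => ?_
        simp only
        rw [← mul_pow]
        exact sq_le_sq.2 (h0 _)
    _ = s ^ 2 := by rw [integral_const_mul, integral_sq_gaussianReal, mul_one]

variable {d n : ℕ} {v : ℝ≥0} {X : Matrix (Fin d) (Fin n) ℝ} {s : Fin n → ℝ} {p : ℝ}

/-- The squared norm of a row of `σ(WX)`, as a function of the row of `W`. -/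
noncomputable def rowSq (σ : ℝ → ℝ) (X : Matrix (Fin d) (Fin n) ℝ) (w : Fin d → ℝ) : ℝ :=
  ∑ j, σ (X.col j ⬝ᵥ w) ^ 2

lemma rowSq_nonneg (w : Fin d → ℝ) : 0 ≤ rowSq σ X w :=
  Finset.sum_nonneg fun _ _ => sq_nonneg _

lemma rowSq_le (h0 : ∀ t, |σ t| ≤ |t|) (w : Fin d → ℝ) :
    rowSq σ X w ≤ ∑ j, (X.col j ⬝ᵥ w) ^ 2 :=
  Finset.sum_le_sum fun _ _ => sq_le_sq.2 (h0 _)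

lemma continuous_dotProduct_right (a : Fin d → ℝ) : Continuous fun w : Fin d → ℝ => a ⬝ᵥ w := by
  unfold dotProduct; fun_prop

lemma continuous_rowSq (hσ : Continuous σ) : Continuous (rowSq σ X) :=
  continuous_finsetSum _ fun _ _ => (hσ.comp (continuous_dotProduct_right _)).pow 2

lemma continuous_feature (hσ : Continuous σ) (u : Fin n → ℝ) : Continuous (feature σ X u) :=
  continuous_finsetSum _ fun _ _ => continuous_const.mul (hσ.comp (continuous_dotProduct_right _))

lemma le_integral_rowSq (hσ : Continuous σ) (h0 : ∀ t, |σ t| ≤ |t|)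
    (hs : ∀ j, s j ^ 2 = v * (X.col j ⬝ᵥ X.col j))
    (hp : ∀ j, p * s j ^ 2 ≤ hermiteCoeff σ 1 (s j) ^ 2) :
    p * ∑ j, s j ^ 2 ≤ ∫ w, rowSq σ X w ∂(gaussVec d v) := by
  unfold rowSq
  rw [integral_finsetSum _ fun j _ => (show MemLp (fun w => σ (X.col j ⬝ᵥ w)) 2 _ from
    memLp_comp_of_abs_le hσ h0 (memLp_dotProduct (X.col j) 2)).integrable_sq, Finset.mul_sum]
  refine Finset.sum_le_sum fun j _ => ?_
  rw [integral_comp_dotProduct (X.col j) (hs j) (g := fun x => σ x ^ 2)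
    (hσ.pow 2).measurable]
  exact (hp j).trans (hermiteCoeff_one_sq_le hσ h0 _)

/-- Cauchy–Schwarz with weights `s j ^ 2`, chosen so that each normalized fourth moment is at most
`48 * s j ^ 2` and the sum closes up to `48 F²`, with `F = ∑ s j ^ 2`. -/
lemma sum_sq_sq_le (hpos : ∀ j, 0 < s j) (a : Fin n → ℝ) :
    (∑ j, a j ^ 2) ^ 2 ≤ (∑ j, s j ^ 2) * ∑ j, a j ^ 4 / s j ^ 2 := by
  refine Finset.sum_sq_le_sum_mul_sum_of_sq_le_mul _ (fun j _ => by positivity)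
    (fun j _ => by positivity) fun j _ => le_of_eq ?_
  have := (hpos j).ne'
  field_simp

lemma integrable_sum_pow_four : Integrable
    (fun w => (∑ j, s j ^ 2) * ∑ j, (X.col j ⬝ᵥ w) ^ 4 / s j ^ 2) (gaussVec d v) :=
  (integrable_finsetSum _ fun j _ => (integrable_pow_four
    (show MemLp (fun w => X.col j ⬝ᵥ w) 4 _ from
      memLp_dotProduct (X.col j) 4)).div_const _).const_mul _

lemma memLp_rowSq (hσ : Continuous σ) (h0 : ∀ t, |σ t| ≤ |t|) (hpos : ∀ j, 0 < s j) :
    MemLp (rowSq σ X) 2 (gaussVec d v) := by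
  rw [memLp_two_iff_integrable_sq (continuous_rowSq hσ).aestronglyMeasurable]
  refine (integrable_sum_pow_four (X := X) (s := s)).mono'
    ((continuous_rowSq hσ).pow 2).aestronglyMeasurable (Filter.Eventually.of_forall fun w => ?_)
  rw [Real.norm_of_nonneg (sq_nonneg _)]
  exact (pow_le_pow_left₀ (rowSq_nonneg w) (rowSq_le h0 w) 2).trans (sum_sq_sq_le hpos _)

lemma integral_rowSq_sq_le (h0 : ∀ t, |σ t| ≤ |t|) (hpos : ∀ j, 0 < s j)
    (hs : ∀ j, s j ^ 2 = v * (X.col j ⬝ᵥ X.col j)) :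
    ∫ w, rowSq σ X w ^ 2 ∂(gaussVec d v) ≤ 48 * (∑ j, s j ^ 2) ^ 2 := by
  calc ∫ w, rowSq σ X w ^ 2 ∂(gaussVec d v)
      ≤ ∫ w, (∑ j, s j ^ 2) * ∑ j, (X.col j ⬝ᵥ w) ^ 4 / s j ^ 2 ∂(gaussVec d v) := by
        refine integral_mono_of_nonneg (Filter.Eventually.of_forall fun w => sq_nonneg _)
          integrable_sum_pow_four (Filter.Eventually.of_forall fun w => ?_)
        exact (pow_le_pow_left₀ (rowSq_nonneg w) (rowSq_le h0 w) 2).trans (sum_sq_sq_le hpos _)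
    _ = (∑ j, s j ^ 2) * ∑ j, (∫ w, (X.col j ⬝ᵥ w) ^ 4 ∂(gaussVec d v)) / s j ^ 2 := by
        rw [integral_const_mul, integral_finsetSum _ fun j _ => (integrable_pow_four
          (show MemLp (fun w => X.col j ⬝ᵥ w) 4 _ from
            memLp_dotProduct (X.col j) 4)).div_const _]
        simp_rw [integral_div]
    _ ≤ (∑ j, s j ^ 2) * ∑ j, 48 * s j ^ 2 := by
        gcongr with j
        rw [div_le_iff₀ (pow_pos (hpos j) 2)]
        refine (integral_dotProduct_pow_four_le _).trans_eq ?_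
        rw [← hs j]
        ring
    _ = _ := by rw [← Finset.mul_sum]; ring

end SecondMoment

end StableRank

/-! ### Exponential moment of the squared row norm. -/

namespace StableRank

variable {σ : ℝ → ℝ} {d n : ℕ} {v : ℝ≥0} {X : Matrix (Fin d) (Fin n) ℝ} {s : Fin n → ℝ} {p : ℝ}

section ExponentialMoment

/-- Jensen: `rowSq / F`, with `F = ∑ s j ^ 2`, is at most the average, with weights `s j ^ 2 / F`,
of the normalized squares `(x_j ⬝ᵥ w)² / s j ^ 2`. These all have the law of `γ²`, so correlations
between columns play no role. -/
lemma exp_mul_rowSq_le (h0 : ∀ t, |σ t| ≤ |t|) (hpos : ∀ j, 0 < s j) (hF : 0 < ∑ j, s j ^ 2)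
    {θ : ℝ} (hθ : 0 ≤ θ) (w : Fin d → ℝ) :
    Real.exp (θ / (∑ j, s j ^ 2) * rowSq σ X w) ≤
      ∑ j, s j ^ 2 / (∑ j, s j ^ 2) * Real.exp (θ / s j ^ 2 * (X.col j ⬝ᵥ w) ^ 2) := by
  set F := ∑ j, s j ^ 2 with hFdef
  have hconv := convexOn_exp.map_sum_le (t := Finset.univ) (w := fun j => s j ^ 2 / F)
    (p := fun j => θ / s j ^ 2 * (X.col j ⬝ᵥ w) ^ 2) (fun j _ => by positivity)
    (by rw [← Finset.sum_div, div_self hF.ne']) (fun _ _ => Set.mem_univ _)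
  simp only [smul_eq_mul] at hconv
  refine le_trans (Real.exp_le_exp.2 ?_) hconv
  calc θ / F * rowSq σ X w ≤ θ / F * ∑ j, (X.col j ⬝ᵥ w) ^ 2 := by
        gcongr
        exact rowSq_le h0 w
    _ = _ := by
        rw [Finset.mul_sum]
        refine Finset.sum_congr rfl fun j _ => ?_
        have := (hpos j).ne'
        field_simp

lemma integrable_exp_dotProduct_sq (hpos : ∀ j, 0 < s j) (hs : ∀ j, s j ^ 2 = v * (X.col j ⬝ᵥ X.col j))
    {θ : ℝ} (hθ : θ < 1 / 2) (j : Fin n) :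
    Integrable (fun w => Real.exp (θ / s j ^ 2 * (X.col j ⬝ᵥ w) ^ 2)) (gaussVec d v) := by
  rw [integrable_comp_dotProduct (X.col j) (hs j)
    (g := fun x => Real.exp (θ / s j ^ 2 * x ^ 2)) (by fun_prop)]
  refine (integrable_exp_mul_sq_gaussianReal hθ).congr (Filter.Eventually.of_forall fun x => ?_)
  have := (hpos j).ne'
  simp only
  congr 1
  field_simp

lemma integral_exp_dotProduct_sq (hpos : ∀ j, 0 < s j)
    (hs : ∀ j, s j ^ 2 = v * (X.col j ⬝ᵥ X.col j)) {θ : ℝ} (hθ : θ < 1 / 2) (j : Fin n) :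
    ∫ w, Real.exp (θ / s j ^ 2 * (X.col j ⬝ᵥ w) ^ 2) ∂(gaussVec d v) = (√(1 - 2 * θ))⁻¹ := by
  rw [integral_comp_dotProduct (X.col j) (hs j)
    (g := fun x => Real.exp (θ / s j ^ 2 * x ^ 2)) (by fun_prop),
    ← integral_exp_mul_sq_gaussianReal hθ]
  refine integral_congr_ae (Filter.Eventually.of_forall fun x => ?_)
  have := (hpos j).ne'
  simp only
  congr 1
  field_simp

lemma integrable_exp_rowSq (hσ : Continuous σ) (h0 : ∀ t, |σ t| ≤ |t|) (hpos : ∀ j, 0 < s j)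
    (hF : 0 < ∑ j, s j ^ 2) (hs : ∀ j, s j ^ 2 = v * (X.col j ⬝ᵥ X.col j))
    {θ : ℝ} (hθ0 : 0 ≤ θ) (hθ : θ < 1 / 2) :
    Integrable (fun w => Real.exp (θ / (∑ j, s j ^ 2) * rowSq σ X w)) (gaussVec d v) := by
  refine (integrable_finsetSum Finset.univ fun j _ =>
    (integrable_exp_dotProduct_sq hpos hs hθ j).const_mul (s j ^ 2 / (∑ j, s j ^ 2))).mono' ?_ ?_
  · exact (Real.continuous_exp.comp
      (continuous_const.mul (continuous_rowSq hσ))).aestronglyMeasurable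
  · refine Filter.Eventually.of_forall fun w => ?_
    rw [Real.norm_of_nonneg (Real.exp_pos _).le]
    exact exp_mul_rowSq_le h0 hpos hF hθ0 w

lemma integral_exp_rowSq_le (hσ : Continuous σ) (h0 : ∀ t, |σ t| ≤ |t|) (hpos : ∀ j, 0 < s j)
    (hF : 0 < ∑ j, s j ^ 2) (hs : ∀ j, s j ^ 2 = v * (X.col j ⬝ᵥ X.col j))
    {θ : ℝ} (hθ0 : 0 ≤ θ) (hθ : θ ≤ 1 / 4) :
    ∫ w, Real.exp (θ / (∑ j, s j ^ 2) * rowSq σ X w) ∂(gaussVec d v) ≤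
      Real.exp (θ + 2 * θ ^ 2) := by
  have hθ' : θ < 1 / 2 := by linarith
  have hi := fun j => (integrable_exp_dotProduct_sq hpos hs hθ' j).const_mul (s j ^ 2 / (∑ j, s j ^ 2))
  calc _ ≤ ∫ w, ∑ j, s j ^ 2 / (∑ j, s j ^ 2) * Real.exp (θ / s j ^ 2 * (X.col j ⬝ᵥ w) ^ 2)
          ∂(gaussVec d v) :=
        integral_mono (integrable_exp_rowSq hσ h0 hpos hF hs hθ0 hθ')
          (integrable_finsetSum _ fun j _ => hi j) (exp_mul_rowSq_le h0 hpos hF hθ0)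
    _ = ∑ j, s j ^ 2 / (∑ j, s j ^ 2) * (√(1 - 2 * θ))⁻¹ := by
        rw [integral_finsetSum _ fun j _ => hi j]
        simp_rw [integral_const_mul, integral_exp_dotProduct_sq hpos hs hθ']
    _ = (√(1 - 2 * θ))⁻¹ := by
        rw [← Finset.sum_mul, ← Finset.sum_div, div_self hF.ne', one_mul]
    _ ≤ _ := inv_sqrt_le_exp hθ0 hθ

end ExponentialMoment

/-! ### A test direction for the operator norm. -/

section Direction

/-- There are output weights of norm at most one for which the feature has second moment at least
`p * v * ‖X‖²`: reweight the entries of a top singular vector by the first Hermite coefficients. -/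
lemma exists_feature_sq_ge (hσ : Continuous σ) (h0 : ∀ t, |σ t| ≤ |t|) (hpos : ∀ j, 0 < s j)
    (hs : ∀ j, s j ^ 2 = v * (X.col j ⬝ᵥ X.col j)) (hp0 : 0 < p)
    (hp : ∀ j, p * s j ^ 2 ≤ hermiteCoeff σ 1 (s j) ^ 2) :
    ∃ u : Fin n → ℝ, u ⬝ᵥ u ≤ 1 ∧
      p * (v * opNorm X ^ 2) ≤ ∫ w, feature σ X u w ^ 2 ∂(gaussVec d v) := by
  obtain ⟨y, hy1, hy2⟩ := exists_opNorm_sq_eq X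
  set h : Fin n → ℝ := fun j => hermiteCoeff σ 1 (s j) with hh
  have hh2 : ∀ j, 0 < h j ^ 2 := fun j =>
    lt_of_lt_of_le (mul_pos hp0 (pow_pos (hpos j) 2)) (hp j)
  have hne : ∀ j, h j ≠ 0 := fun j hj => by simpa [hj] using hh2 j
  -- Dividing by `h j` cancels the Hermite coefficient produced by the Gaussian projection; the
  -- factor `√p * s j` keeps `|u j| ≤ |y j|`, because `p * s j ^ 2 ≤ h j ^ 2`.
  set u : Fin n → ℝ := fun j => √p * y j * s j / h j with hu
  have hsp : √p ^ 2 = p := Real.sq_sqrt hp0.le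
  refine ⟨u, ?_, ?_⟩
  · refine le_trans (Finset.sum_le_sum fun j _ => ?_) hy1
    have : u j * u j = (p * s j ^ 2) / h j ^ 2 * (y j * y j) := by
      have := hne j
      simp only [hu]
      field_simp
      rw [hsp]
      ring
    rw [this]
    exact mul_le_of_le_one_left (mul_self_nonneg _) ((div_le_one (hh2 j)).2 (hp j))
  · set z := X.mulVec y with hz
    have hcov : ∫ w, feature σ X u w * (z ⬝ᵥ w) ∂(gaussVec d v) = √p * (v * (z ⬝ᵥ z)) := by
      have hmem : ∀ j, MemLp (fun w => σ (X.col j ⬝ᵥ w)) 2 (gaussVec d v) := fun j =>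
        memLp_comp_of_abs_le hσ h0 (memLp_dotProduct (X.col j) 2)
      have hi : ∀ j, Integrable (fun w => u j * (σ (X.col j ⬝ᵥ w) * (z ⬝ᵥ w))) (gaussVec d v) :=
        fun j => (MemLp.integrable_mul (p := 2) (q := 2) (hmem j)
          (memLp_dotProduct z 2)).const_mul _
      simp only [feature, Finset.sum_mul, mul_assoc]
      rw [integral_finsetSum _ fun j _ => hi j]
      have hterm : ∀ j, ∫ w, u j * (σ (X.col j ⬝ᵥ w) * (z ⬝ᵥ w)) ∂(gaussVec d v) =
          √p * v * (y j * (X.col j ⬝ᵥ z)) := by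
        intro j
        have hcol : X.col j ⬝ᵥ X.col j ≠ 0 := fun hc => by
          have := hs j
          rw [hc, mul_zero] at this
          exact (pow_pos (hpos j) 2).ne' this
        rw [integral_const_mul, integral_comp_dotProduct_mul _ _ hcol hσ.measurable (hmem j),
          integral_comp_dotProduct (X.col j) (hs j) (g := fun x => σ x * x)
            (hσ.mul continuous_id).measurable]
        have : ∀ x, σ (s j * x) * (s j * x) = s j * (σ (s j * x) * x) := fun x => by ring
        simp_rw [this]
        rw [integral_const_mul, ← hermiteCoeff_one]
        change u j * ((X.col j ⬝ᵥ z) / (X.col j ⬝ᵥ X.col j) * (s j * h j)) = _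
        have hhj := hne j
        have : u j * ((X.col j ⬝ᵥ z) / (X.col j ⬝ᵥ X.col j) * (s j * h j)) =
            √p * y j * (s j ^ 2) * ((X.col j ⬝ᵥ z) / (X.col j ⬝ᵥ X.col j)) := by
          simp only [hu]
          field_simp
        rw [this, hs j]
        field_simp
      simp_rw [hterm]
      rw [← Finset.mul_sum, mul_assoc]
      congr 2
      simp only [hz, dotProduct, Matrix.mulVec, Matrix.col_apply, Finset.mul_sum, Finset.sum_mul]
      rw [Finset.sum_comm]
      refine Finset.sum_congr rfl fun i _ => ?_
      rw [Finset.sum_comm]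
      refine Finset.sum_congr rfl fun j _ => Finset.sum_congr rfl fun l _ => ?_
      ring
    have hsq : ∫ w, (z ⬝ᵥ w) ^ 2 ∂(gaussVec d v) = v * (z ⬝ᵥ z) := by
      simpa [sq] using integral_dotProduct_mul (v := v) z z
    -- `√p` is the ratio of the covariance `√p * v * (z ⬝ᵥ z)` to the variance `v * (z ⬝ᵥ z)`, hence
    -- the optimal multiplier.
    have key := two_mul_integral_sub_le
      (show MemLp (feature σ X u) 2 (gaussVec d v) from memLp_feature hσ h0 X u 2)
      (show MemLp (fun w => z ⬝ᵥ w) 2 (gaussVec d v) from memLp_dotProduct z 2) (√p)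
    rw [hcov, hsq] at key
    have h1 : p * (v * (z ⬝ᵥ z)) ≤ ∫ w, feature σ X u w ^ 2 ∂(gaussVec d v) := by
      calc p * (v * (z ⬝ᵥ z)) = 2 * √p * (√p * (v * (z ⬝ᵥ z))) - √p ^ 2 * (v * (z ⬝ᵥ z)) := by
            linear_combination (-(v * (z ⬝ᵥ z))) * hsp
        _ ≤ _ := key
    refine le_trans ?_ h1
    have : (0 : ℝ) ≤ v := v.2
    gcongr

end Direction

/-! ### Chernoff bounds for sums over the rows of `W`. -/

section Tails

variable {Ω : Type*} [MeasurableSpace Ω] {P : Measure Ω} {k : ℕ}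
  {W : Ω → Matrix (Fin k) (Fin d) ℝ}

/-- Lower tail for the sum over the rows of a nonnegative function with controlled moments. -/
lemma IsGaussianMatrix.measureReal_sum_row_le [IsProbabilityMeasure P] (hW : IsGaussianMatrix P W)
    {g : (Fin d → ℝ) → ℝ} (hg : Continuous g) (hg0 : ∀ w, 0 ≤ g w)
    (hL : MemLp g 2 (gaussVec d (d : ℝ≥0)⁻¹)) {b M ε : ℝ} (hb : 0 ≤ b) (hε : 0 ≤ ε) (hM : 0 < M)
    (hmean : b ≤ ∫ w, g w ∂(gaussVec d (d : ℝ≥0)⁻¹))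
    (hsq : ∫ w, g w ^ 2 ∂(gaussVec d (d : ℝ≥0)⁻¹) ≤ M) :
    P.real {ω | ∑ i, g (W ω i) ≤ k * ((1 - ε) * b)} ≤
      Real.exp (-(k * (ε ^ 2 * b ^ 2 / (2 * M)))) := by
  refine measureReal_sum_le_of_nonneg (Y := fun i ω => g (W ω i))
    (hW.iIndepFun_row.comp (fun _ => g) fun _ => hg.measurable) (fun i => ?_)
    (fun i ω => hg0 _) hb hε hM (fun i => ?_) (fun i => ?_)
  · have h := hW.hasLaw_row i
    rw [← h.map_eq] at hL
    exact (memLp_map_measure_iff hg.aestronglyMeasurable h.aemeasurable).1 hL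
  · rw [← (hW.hasLaw_row i).integral_comp hg.aestronglyMeasurable] at hmean
    exact hmean
  · rw [← (hW.hasLaw_row i).integral_comp (f := fun w => g w ^ 2)
      (hg.pow 2).aestronglyMeasurable] at hsq
    exact hsq

/-- Upper tail for the sum over the rows of a function with controlled exponential moment. -/
lemma IsGaussianMatrix.measureReal_le_sum_row [IsProbabilityMeasure P] (hW : IsGaussianMatrix P W)
    {g : (Fin d → ℝ) → ℝ} (hg : Continuous g) {t a A : ℝ} (ht : 0 ≤ t)
    (hint : Integrable (fun w => Real.exp (t * g w)) (gaussVec d (d : ℝ≥0)⁻¹))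
    (hA : ∫ w, Real.exp (t * g w) ∂(gaussVec d (d : ℝ≥0)⁻¹) ≤ Real.exp A) :
    P.real {ω | k * a ≤ ∑ i, g (W ω i)} ≤ Real.exp (k * (A - t * a)) := by
  have hc : Continuous fun w => Real.exp (t * g w) := by fun_prop
  refine measureReal_le_sum_of_mgf_le (Y := fun i ω => g (W ω i))
    (hW.iIndepFun_row.comp (fun _ => g) fun _ => hg.measurable)
    (fun i => hg.measurable.comp_aemeasurable (hW.hasLaw_row i).aemeasurable) ht
    (fun i => ?_) (fun i => ?_)
  · have h := hW.hasLaw_row i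
    rw [← h.map_eq] at hint
    exact (integrable_map_measure hc.aestronglyMeasurable h.aemeasurable).1 hint
  · rw [← (hW.hasLaw_row i).integral_comp hc.aestronglyMeasurable] at hA
    exact hA

end Tails

end StableRank

/-! ### Assembling the norm bounds and the stable rank bound. -/

namespace StableRank

variable {σ : ℝ → ℝ} {k d n : ℕ} {X : Matrix (Fin d) (Fin n) ℝ} {p : ℝ}

lemma map_mul_apply (W : Matrix (Fin k) (Fin d) ℝ) (X : Matrix (Fin d) (Fin n) ℝ) (i : Fin k)
    (j : Fin n) : (W * X).map σ i j = σ (X.col j ⬝ᵥ W i) := by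
  rw [Matrix.map_apply, Matrix.mul_apply, dotProduct_comm]
  rfl

lemma frobNorm_map_mul_sq (W : Matrix (Fin k) (Fin d) ℝ) :
    frobNorm ((W * X).map σ) ^ 2 = ∑ i, rowSq σ X (W i) := by
  simp_rw [frobNorm_sq, map_mul_apply, rowSq]

lemma sum_feature_sq_le (W : Matrix (Fin k) (Fin d) ℝ) {u : Fin n → ℝ} (hu : u ⬝ᵥ u ≤ 1) :
    ∑ i, feature σ X u (W i) ^ 2 ≤ opNorm ((W * X).map σ) ^ 2 := by
  have h := mulVec_dotProduct_self_le ((W * X).map σ) u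
  have h2 : ((W * X).map σ).mulVec u ⬝ᵥ ((W * X).map σ).mulVec u =
      ∑ i, feature σ X u (W i) ^ 2 := by
    unfold dotProduct
    refine Finset.sum_congr rfl fun i _ => ?_
    have : ((W * X).map σ).mulVec u i = feature σ X u (W i) := by
      simp only [Matrix.mulVec, dotProduct, feature]
      refine Finset.sum_congr rfl fun j _ => ?_
      rw [map_mul_apply, mul_comm]
      rfl
    rw [this, sq]
  rw [← h2]
  exact h.trans (mul_le_of_le_one_right (sq_nonneg _) hu)

/-- Since division by zero gives `0`, the parameter vanishes when `d = 0` or the column is zero;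
positivity of `p` thus already encodes nonzero columns. -/
lemma pos_of_columnParam_pos {j : Fin n} (h : 0 < columnParam σ X j) :
    0 < d ∧ 0 < colNorm X j := by
  unfold columnParam at h
  constructor
  · rcases Nat.eq_zero_or_pos d with hd | hd
    · simp [hd] at h
    · exact hd
  · refine lt_of_le_of_ne (norm_nonneg _) fun hc => ?_
    rw [show colNorm X j = 0 from hc.symm] at h
    simp at h

open scoped Matrix.Norms.L2Operator in
lemma opNorm_pos {j : Fin n} (h : 0 < colNorm X j) : 0 < opNorm X := by
  have h1 := mulVec_dotProduct_self_le X (Pi.single j 1)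
  rw [Matrix.mulVec_single_one, ← colNorm_sq] at h1
  have h2 : 0 ≤ opNorm X := norm_nonneg X
  refine lt_of_le_of_ne h2 fun hc => ?_
  rw [← hc] at h1
  nlinarith [pow_pos h 2]

/-- The stable rank bound follows from the norm bounds. -/
lemma stableRank_map_le {W : Matrix (Fin k) (Fin d) ℝ} {ε : ℝ} (hd : 0 < d) (hop : 0 < opNorm X)
    (hp : 0 < p) (hε : ε < 1) (h : NormBounds σ p ε W X) :
    stableRank ((W * X).map σ) ≤ (1 + ε) / (1 - ε) * (1 / p) * stableRank X := by
  obtain ⟨-, h2, h3⟩ := h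
  unfold stableRank
  set FA := frobNorm ((W * X).map σ) ^ 2
  set OA := opNorm ((W * X).map σ) ^ 2
  set F := frobNorm X ^ 2
  have hO : 0 < opNorm X ^ 2 := pow_pos hop 2
  set O := opNorm X ^ 2
  have hd' : (0 : ℝ) < d := by exact_mod_cast hd
  have hε' : 0 < 1 - ε := by linarith
  have hlow : 0 < (1 - ε) * (p / d) * O := by positivity
  have hOA0 : 0 ≤ OA := sq_nonneg _
  -- For `k = 0` the convention `1 / 0 = 0` would contradict the strictly positive lower bound in
  -- `h3`.
  have hk : (0 : ℝ) < 1 / k := by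
    rcases (show (0 : ℝ) ≤ 1 / k by positivity).lt_or_eq with h | h
    · exact h
    · rw [← h, zero_mul] at h3
      linarith
  calc FA / OA = (1 / k * FA) / (1 / k * OA) := (mul_div_mul_left _ _ hk.ne').symm
    _ ≤ ((1 + ε) * (1 / d) * F) / ((1 - ε) * (p / d) * O) := by
        have : 0 ≤ 1 / k * FA := mul_nonneg hk.le (sq_nonneg _)
        exact div_le_div₀ (this.trans h2) h2 hlow h3
    _ = (1 + ε) / (1 - ε) * (1 / p) * (F / O) := by
        field_simp

lemma columnParam_bound {j : Fin n} (hd : 0 < d) (hc : 0 < colNorm X j)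
    (hp : p ≤ columnParam σ X j) :
    p * (colNorm X j / √(d : ℝ)) ^ 2 ≤ hermiteCoeff σ 1 (colNorm X j / √(d : ℝ)) ^ 2 := by
  have hd' : (0 : ℝ) < d := by exact_mod_cast hd
  unfold columnParam at hp
  rw [div_pow (colNorm X j), Real.sq_sqrt hd'.le]
  calc p * (colNorm X j ^ 2 / d)
      ≤ (d / colNorm X j ^ 2 * hermiteCoeff σ 1 (colNorm X j / √(d : ℝ)) ^ 2) *
          (colNorm X j ^ 2 / d) := by gcongr
    _ = _ := by field_simp

/-- The norm bounds hold with high probability. -/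
lemma IsGaussianMatrix.measureReal_normBounds_ge {Ω : Type*} [MeasurableSpace Ω] {P : Measure Ω}
    [IsProbabilityMeasure P] {W : Ω → Matrix (Fin k) (Fin d) ℝ} (hW : IsGaussianMatrix P W)
    (hσ : LipschitzWith 1 σ) (h0 : ∀ t, |σ t| ≤ |t|) (hn : Nonempty (Fin n)) (hd : 0 < d)
    (hc : ∀ j, 0 < colNorm X j) (hp0 : 0 < p) (hp : ∀ j, p ≤ columnParam σ X j)
    {ε : ℝ} (hε0 : 0 < ε) (hε : ε < 1) (hk : 0 < k) :
    1 - 8 * Real.exp (-(1 / 25000) * ε ^ 2 * p ^ 2 * k) ≤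
      P.real {ω | NormBounds σ p ε (W ω) X} := by
  have hσc := hσ.continuous
  have hd' : (0 : ℝ) < d := by exact_mod_cast hd
  have hk' : (0 : ℝ) < k := by exact_mod_cast hk
  set v : ℝ≥0 := (d : ℝ≥0)⁻¹ with hv
  have hvR : (v : ℝ) = 1 / d := by simp [hv]
  have hv0 : v ≠ 0 := by
    rw [hv]
    exact inv_ne_zero (by exact_mod_cast hd.ne')
  set s : Fin n → ℝ := fun j => colNorm X j / √(d : ℝ) with hsdef
  have hpos : ∀ j, 0 < s j := fun j => div_pos (hc j) (Real.sqrt_pos.2 hd')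
  have hs : ∀ j, s j ^ 2 = v * (X.col j ⬝ᵥ X.col j) := fun j => by
    rw [hvR, ← colNorm_sq, hsdef]
    simp only
    rw [div_pow, Real.sq_sqrt hd'.le]
    ring
  have hps : ∀ j, p * s j ^ 2 ≤ hermiteCoeff σ 1 (s j) ^ 2 := fun j =>
    columnParam_bound hd (hc j) (hp j)
  -- Bessel and `|σ t| ≤ |t|` bound the squared coefficient by `s j ^ 2`. This lets `p`-free rates
  -- be weakened to rates with `p ^ 2`.
  have hp1 : p ≤ 1 := by
    obtain ⟨j⟩ := hn
    have h1 := (hps j).trans ((hermiteCoeff_one_sq_le hσc h0 _).trans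
      (integral_comp_mul_sq_le hσc h0 _))
    exact le_of_mul_le_mul_right (by linarith) (pow_pos (hpos j) 2)
  set F := ∑ j, s j ^ 2 with hFdef
  have hF : 0 < F := Finset.sum_pos (fun j _ => pow_pos (hpos j) 2) Finset.univ_nonempty
  have hFX : F = 1 / d * frobNorm X ^ 2 := by
    rw [hFdef, frobNorm_sq_eq_sum_col, ← hvR, Finset.mul_sum]
    exact Finset.sum_congr rfl fun j _ => hs j
  -- lower bound for the Frobenius norm
  have hB1 : P.real {ω | ∑ i, rowSq σ X (W ω i) ≤ k * ((1 - ε) * (p * F))} ≤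
      Real.exp (-(1 / 25000) * ε ^ 2 * p ^ 2 * k) := by
    refine (hW.measureReal_sum_row_le (continuous_rowSq hσc) rowSq_nonneg
      (memLp_rowSq hσc h0 hpos) (b := p * F) (M := 48 * F ^ 2) (by positivity) hε0.le
      (by positivity) (le_integral_rowSq hσc h0 hs hps)
      (integral_rowSq_sq_le h0 hpos hs)).trans ?_
    rw [Real.exp_le_exp, show ε ^ 2 * (p * F) ^ 2 / (2 * (48 * F ^ 2)) = ε ^ 2 * p ^ 2 / 96 by
      field_simp; norm_num]
    have : 0 ≤ k * (ε ^ 2 * p ^ 2) := by positivity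
    linarith
  -- upper bound for the Frobenius norm
  have hB2 : P.real {ω | k * ((1 + ε) * F) ≤ ∑ i, rowSq σ X (W ω i)} ≤
      Real.exp (-(1 / 25000) * ε ^ 2 * p ^ 2 * k) := by
    -- With `θ = ε/4` the exponent `θ + 2θ² - θ(1 + ε)` attains its minimum `-ε²/8`.
    refine (hW.measureReal_le_sum_row (continuous_rowSq hσc) (t := ε / 4 / F)
      (a := (1 + ε) * F) (by positivity)
      (integrable_exp_rowSq hσc h0 hpos hF hs (by positivity) (by linarith))
      (integral_exp_rowSq_le hσc h0 hpos hF hs (by positivity) (by linarith))).trans ?_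
    rw [Real.exp_le_exp, show ε / 4 / F * ((1 + ε) * F) = ε / 4 * (1 + ε) by field_simp]
    have h1 : 0 ≤ k * ε ^ 2 := by positivity
    have h2 : p ^ 2 ≤ 1 := pow_le_one₀ hp0.le hp1
    nlinarith [mul_le_mul_of_nonneg_left h2 h1]
  -- lower bound for the operator norm
  obtain ⟨u, hu, hub⟩ := exists_feature_sq_ge hσc h0 hpos hs hp0 hps
  set f := feature σ X u with hf
  set b := ∫ w, f w ^ 2 ∂(gaussVec d v) with hb
  set O := v * opNorm X ^ 2 with hO
  have hop : 0 < opNorm X := opNorm_pos (hc (Classical.choice hn))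
  have hO0 : 0 < O := mul_pos (by rw [hvR]; positivity) (pow_pos hop 2)
  have hb0 : 0 < b := lt_of_lt_of_le (mul_pos hp0 hO0) hub
  have hcol : ∀ j, X.col j ⬝ᵥ X.col j ≠ 0 := fun j => by
    rw [← colNorm_sq]; exact (pow_pos (hc j) 2).ne'
  have hfour := integral_feature_pow_four_le hσ h0 hv0 hcol hu (sq_nonneg (opNorm X))
    (mulVec_dotProduct_self_le X)
  -- Both `O ≤ b / p` and `b ≤ b / p` hold, whence `12292 = 12288 + 4`. Comparing with `b` rather
  -- than `O` makes the tail relative to the true mean.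
  have hM : ∫ w, (f w ^ 2) ^ 2 ∂(gaussVec d v) ≤ 12292 * (b ^ 2 / p ^ 2) := by
    have h1 : ∀ w, (f w ^ 2) ^ 2 = f w ^ 4 := fun w => by ring
    simp_rw [h1]
    refine hfour.trans ?_
    have h2 : O ^ 2 ≤ b ^ 2 / p ^ 2 := by
      rw [le_div_iff₀ (by positivity), ← mul_pow]
      exact pow_le_pow_left₀ (by positivity) (by linarith) 2
    have h3 : b ^ 2 ≤ b ^ 2 / p ^ 2 :=
      le_div_self (sq_nonneg b) (by positivity) (pow_le_one₀ hp0.le hp1)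
    linarith
  have hfL : MemLp (fun w => f w ^ 2) 2 (gaussVec d v) := by
    have hmeas : AEStronglyMeasurable (fun w => f w ^ 2) (gaussVec d v) :=
      ((continuous_feature hσc u).pow 2).aestronglyMeasurable
    rw [memLp_two_iff_integrable_sq hmeas]
    have h4 : MemLp f 4 (gaussVec d v) := memLp_feature hσc h0 X u 4
    refine (integrable_pow_four h4).congr (Filter.Eventually.of_forall fun w => ?_)
    simp only
    ring
  have hB3 : P.real {ω | ∑ i, f (W ω i) ^ 2 ≤ k * ((1 - ε) * b)} ≤
      Real.exp (-(1 / 25000) * ε ^ 2 * p ^ 2 * k) := by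
    refine (hW.measureReal_sum_row_le (g := fun w => f w ^ 2) ((continuous_feature hσc u).pow 2)
      (fun w => sq_nonneg _) hfL (b := b) (M := 12292 * (b ^ 2 / p ^ 2)) hb0.le hε0.le
      (by positivity) le_rfl hM).trans ?_
    -- The slowest of the three rates: `24584 = 2 · 12292` accounts for the constant `1 / 25000`.
    rw [Real.exp_le_exp, show ε ^ 2 * b ^ 2 / (2 * (12292 * (b ^ 2 / p ^ 2))) =
      ε ^ 2 * p ^ 2 / 24584 by field_simp; norm_num]
    have : 0 ≤ k * (ε ^ 2 * p ^ 2) := by positivity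
    linarith
  set B1 := {ω | ∑ i, rowSq σ X (W ω i) ≤ k * ((1 - ε) * (p * F))}
  set B2 := {ω | k * ((1 + ε) * F) ≤ ∑ i, rowSq σ X (W ω i)}
  set B3 := {ω | ∑ i, f (W ω i) ^ 2 ≤ k * ((1 - ε) * b)}
  -- Covering the whole space needs only monotonicity and subadditivity, so measurability of the
  -- good event is not required. Three failure events fit within the allowed factor `8`.
  have hcover : (Set.univ : Set Ω) ⊆ {ω | NormBounds σ p ε (W ω) X} ∪ (B1 ∪ (B2 ∪ B3)) := by
    intro ω _
    by_contra hω
    simp only [Set.mem_union, not_or] at hω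
    obtain ⟨hgood, h1, h2, h3⟩ := hω
    simp only [B1, B2, B3, Set.mem_ofPred_eq, not_le] at h1 h2 h3
    refine hgood ⟨?_, ?_, ?_⟩
    · rw [frobNorm_map_mul_sq, one_div_mul_eq_div, le_div_iff₀ hk']
      calc _ = k * ((1 - ε) * (p * F)) := by rw [hFX]; ring
        _ ≤ _ := h1.le
    · rw [frobNorm_map_mul_sq, one_div_mul_eq_div, div_le_iff₀ hk']
      calc _ ≤ k * ((1 + ε) * F) := h2.le
        _ = _ := by rw [hFX]; ring
    · rw [one_div_mul_eq_div, le_div_iff₀ hk']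
      calc _ = k * ((1 - ε) * (p * O)) := by rw [hO, hvR]; ring
        _ ≤ k * ((1 - ε) * b) := by
            have : 0 ≤ 1 - ε := by linarith
            gcongr
        _ ≤ _ := h3.le.trans (sum_feature_sq_le (W ω) hu)
  have htot : 1 ≤ P.real {ω | NormBounds σ p ε (W ω) X} +
      (P.real B1 + (P.real B2 + P.real B3)) := by
    calc (1 : ℝ) = P.real Set.univ := by simp
      _ ≤ P.real ({ω | NormBounds σ p ε (W ω) X} ∪ (B1 ∪ (B2 ∪ B3))) := measureReal_mono hcover
      _ ≤ _ := (measureReal_union_le _ _).trans (add_le_add_right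
          ((measureReal_union_le _ _).trans (add_le_add_right (measureReal_union_le _ _) _)) _)
  linarith [Real.exp_pos (-(1 / 25000) * ε ^ 2 * p ^ 2 * k)]

end StableRank

theorem mainTheorem9 :
    ∃ c : ℝ, 0 < c ∧
      ∀ {Ω : Type*} [MeasurableSpace Ω] (P : Measure Ω) [IsProbabilityMeasure P]
        (k d n : ℕ) (W : Ω → Matrix (Fin k) (Fin d) ℝ)
        (_ : StableRank.IsGaussianMatrix P W)
        (X : Matrix (Fin d) (Fin n) ℝ) (σ : ℝ → ℝ)
        (_ : LipschitzWith 1 σ) (_ : ∀ t, |σ t| ≤ |t|)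
        (p : ℝ) (_ : IsLeast (Set.range (StableRank.columnParam σ X)) p) (_ : 0 < p)
        (ε : ℝ) (_ : 0 < ε) (_ : ε < 1),
        1 - 8 * Real.exp (-c * ε ^ 2 * p ^ 2 * k) ≤
          P.real {ω | StableRank.NormBounds σ p ε (W ω) X} ∧
        ∀ ω, StableRank.NormBounds σ p ε (W ω) X →
          StableRank.stableRank ((W ω * X).map σ) ≤
            (1 + ε) / (1 - ε) * (1 / p) * StableRank.stableRank X := by
  refine ⟨1 / 25000, by norm_num, ?_⟩
  intro Ω _ P _ k d n W hW X σ hσ h0 p hp hp0 ε hε0 hε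
  have hple : ∀ j, p ≤ StableRank.columnParam σ X j := fun j => hp.2 ⟨j, rfl⟩
  have hj : ∀ j, 0 < d ∧ 0 < StableRank.colNorm X j := fun j =>
    StableRank.pos_of_columnParam_pos (hp0.trans_le (hple j))
  -- The minimum is attained, so a column exists and `n ≥ 1`.
  obtain ⟨j₀, -⟩ := hp.1
  refine ⟨?_, fun ω hω => StableRank.stableRank_map_le (hj j₀).1
    (StableRank.opNorm_pos (hj j₀).2) hp0 hε hω⟩
  -- For `k = 0` the claimed probability bound is `1 - 8 < 0`.
  rcases Nat.eq_zero_or_pos k with hk | hk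
  · have : (0 : ℝ) ≤ P.real {ω | StableRank.NormBounds σ p ε (W ω) X} := measureReal_nonneg
    simp only [hk, Nat.cast_zero, mul_zero, Real.exp_zero]
    linarith
  · exact hW.measureReal_normBounds_ge hσ h0 ⟨j₀⟩ (hj j₀).1 (fun j => (hj j).2) hp0 hple hε0 hε hk
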